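/- Let $\tau$ be a countable set of function symbols (constants are $0$-ary symbols) and let $T$ be a set of equations in $\tau$; an *algebra* is a model of $T$. A subset $A$ of an algebra is a *free basis* (of the subalgebra $\langle A\rangle$) if distinct elements of $A$ satisfy only equations provable from $T$; an algebra is *free* if it is generated by a free basis. $F_\kappa$ is the free algebra on $\kappa$ generators, and $*$, $*_M$ are the free product and the free product over a common subalgebra $M$ in the variety (all formal terms in constants from the factors, identified according to $T$ and the diagrams of the factors, the copies of $M$ being identified). "$N/M$ is free" means that $M$ is a subalgebra of $N$ and there is a free basis $A\subseteq N$ such that $N=\langle M\cup A\rangle$ and between elements of $\langle A\rangle$ and $M$ only those equations hold that follow from $T$ and the diagram of $M$; where $N$ is a free product, $M$ is regarded as a subalgebra of it through the canonical map, which is thus required to be injective. An algebra $M$ of cardinality $\lambda$ is *almost free* if it is the union of an increasing continuous chain $\langle M_\nu:\nu<\mathrm{cf}(\lambda)\rangle$ of free subalgebras of cardinality $<\lambda$, and *essentially free* if $M*M'$ is free for some free algebra $M'$. $\mathrm{EINC}(T)$ is the class of cardinals $\lambda$ such that some algebra of cardinality $\lambda$ is almost free and essentially free but not free. $\mathrm{Pr}_1(T)$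 says that there are a countably generated algebra $N$ and a subalgebra $M$ of $N$ such that (i) $M$ is free; (ii) $N*F_{\aleph_0}/M$ is free; (iii) $(*_M\{N:n\in\omega\})*F_{\aleph_0}\,/\,M*F_{\aleph_0}$ is not free. **Theorem.** If $\mathrm{Pr}_1(T)$ holds, then $\lambda\in\mathrm{EINC}(T)$ for every successor cardinal $\lambda=\mu^+$ with $\mu$ infinite. More precisely, whenever $N,M$ witness $\mathrm{Pr}_1(T)$, the algebra $(*_M\{N:\alpha<\lambda\})*F_\mu$ has cardinality $\lambda$ and is almost free and essentially free but not free. -/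

import Mathlib

open FirstOrder FirstOrder.Language
open scoped Cardinal

/-!
# Varieties in a countable vocabulary, free products, and the essentially free spectrum

An algebraic first-order language `L` (no relation symbols) is a vocabulary of function symbols.
Since the vocabularies of interest are countable, they are taken in `Type`; algebras may live in an
arbitrary universe.
-/

universe u w

namespace Variety

variable {L : FirstOrder.Language.{0, 0}}

/-- A set of equations `∀ x₀ x₁ …, σ₁ = σ₂`, each given by its pair of terms `(σ₁, σ₂)` in the
variables `x₀, x₁, …`. -/
abbrev Equations (L : FirstOrder.Language.{0, 0}) : Type := Set (L.Term ℕ × L.Term ℕ)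

/-- `A` is a member of `Mod(T)`. -/
def IsModel (T : Equations L) (A : Type u) [L.Structure A] : Prop :=
  ∀ e ∈ T, ∀ v : ℕ → A, e.1.realize v = e.2.realize v

/-- `Provable T E s t`: the equation `s = t` between terms in the constants `X` is derivable from
the laws in `T` and the equations `E` between such terms, in equational logic. -/
inductive Provable (T : Equations L) {X : Type u} (E : L.Term X → L.Term X → Prop) :
    L.Term X → L.Term X → Prop
  | hyp {s t : L.Term X} : E s t → Provable T E s t
  | law {e : L.Term ℕ × L.Term ℕ} (he : e ∈ T) (v : ℕ → L.Term X) :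
      Provable T E (e.1.subst v) (e.2.subst v)
  | refl (s : L.Term X) : Provable T E s s
  | symm {s t : L.Term X} : Provable T E s t → Provable T E t s
  | trans {s t r : L.Term X} : Provable T E s t → Provable T E t r → Provable T E s r
  | congr {n : ℕ} (f : L.Functions n) (s t : Fin n → L.Term X) :
      (∀ i, Provable T E (s i) (t i)) → Provable T E (Term.func f s) (Term.func f t)

/-- The empty set of equations. -/
def noEquations {X : Type u} : L.Term X → L.Term X → Prop := fun _ _ => False

/-- The (positive) diagram of `A`, written with the constant `c a` for `a : A`: all equations
`f (c a₁, …, c aₙ) = c (f (a₁, …, aₙ))`. -/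
inductive Diagram {A : Type u} [L.Structure A] {X : Type w} (c : A → X) :
    L.Term X → L.Term X → Prop
  | mk {n : ℕ} (f : L.Functions n) (a : Fin n → A) :
      Diagram c (Term.func f fun i => Term.var (c (a i)))
        (Term.var (c (Structure.funMap f a)))

/-! ### Algebras presented by generators and equations -/

section Presented

variable (T : Equations L) {X : Type u} (E : L.Term X → L.Term X → Prop)

/-- Terms modulo provable equality from `T` and `E`. -/
def provableSetoid : Setoid (L.Term X) where
  r := Provable T E
  iseqv := ⟨Provable.refl, Provable.symm, Provable.trans⟩

/-- The algebra in the variety `T` presented by the generators `X` and the equations `E`: all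
formal terms with constants in `X`, identified according to `T` and `E`. -/
def Presented : Type u := Quotient (provableSetoid T E)

namespace Presented

/-- The class of a formal term. -/
def mk (s : L.Term X) : Presented T E := Quotient.mk (provableSetoid T E) s

/-- The generator named by `x`. -/
def gen (x : X) : Presented T E := mk T E (Term.var x)

variable {T E} in
theorem mk_eq_mk {s t : L.Term X} : mk T E s = mk T E t ↔ Provable T E s t :=
  Quotient.eq (r := provableSetoid T E)

variable {T E} in
theorem mk_surjective (a : Presented T E) : ∃ s, mk T E s = a := Quotient.exists_rep a

variable {T E} in
theorem realize_eq_of_provable {P : Type w} [L.Structure P] (hP : IsModel T P) (v : X → P)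
    (hv : ∀ s t, E s t → s.realize v = t.realize v) {s t : L.Term X} (h : Provable T E s t) :
    s.realize v = t.realize v := by
  induction h with
  | hyp h => exact hv _ _ h
  | law he w => simpa only [Term.realize_subst] using hP _ he _
  | refl => rfl
  | symm _ ih => exact ih.symm
  | trans _ _ ih₁ ih₂ => exact ih₁.trans ih₂
  | congr f s t _ ih => simp only [Term.realize, ih]

noncomputable instance [L.IsAlgebraic] : L.Structure (Presented T E) where
  funMap f a := mk T E (Term.func f fun i => Quotient.out (a i))
  RelMap r _ := isEmptyElim r

variable [L.IsAlgebraic]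

theorem funMap_mk {n : ℕ} (f : L.Functions n) (s : Fin n → L.Term X) :
    Structure.funMap f (fun i => mk T E (s i)) = mk T E (Term.func f s) :=
  mk_eq_mk.2 <| Provable.congr f _ _ fun i =>
    mk_eq_mk.1 (Quotient.out_eq (s := provableSetoid T E) (mk T E (s i)))

theorem realize_mk {Y : Type w} (s : L.Term Y) (v : Y → L.Term X) :
    s.realize (fun y => mk T E (v y)) = mk T E (s.subst v) := by
  induction s with
  | var y => rfl
  | func f ts ih =>
    simp only [Term.realize, Term.subst, ih]
    exact funMap_mk T E f _

theorem isModel : IsModel T (Presented T E) := by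
  intro e he v
  choose s hs using fun n => mk_surjective (v n)
  obtain rfl : (fun n => mk T E (s n)) = v := funext hs
  rw [realize_mk, realize_mk]
  exact mk_eq_mk.2 (Provable.law he s)

variable {T E}

/-- The homomorphism from a presented algebra to an algebra in the variety that is prescribed by
an assignment of the generators satisfying the given equations. -/
def lift {P : Type w} [L.Structure P] (hP : IsModel T P) (v : X → P)
    (hv : ∀ s t, E s t → s.realize v = t.realize v) : Presented T E →[L] P where
  toFun := Quotient.lift (fun s => s.realize v) fun _ _ h => realize_eq_of_provable hP v hv h
  map_fun' {n} f a := by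
    choose s hs using fun i => mk_surjective (a i)
    obtain rfl : (fun i => mk T E (s i)) = a := funext hs
    rw [funMap_mk]
    rfl
  map_rel' r := isEmptyElim r

theorem lift_gen {P : Type w} [L.Structure P] (hP : IsModel T P) (v : X → P)
    (hv : ∀ s t, E s t → s.realize v = t.realize v) (x : X) : lift hP v hv (gen T E x) = v x :=
  rfl

/-- If `E` contains the diagram of `A`, then `A` maps homomorphically to the presented algebra. -/
def ofDiagram {A : Type w} [L.Structure A] (c : A → X)
    (hc : ∀ s t, Diagram (L := L) c s t → E s t) : A →[L] Presented T E where
  toFun a := gen T E (c a)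
  map_fun' f a :=
    ((funMap_mk T E f fun i => Term.var (c (a i))).trans
      (mk_eq_mk.2 (Provable.hyp (hc _ _ (Diagram.mk f a))))).symm
  map_rel' r := isEmptyElim r

end Presented

end Presented

/-! ### Free algebras and free products -/

section Products

variable [L.IsAlgebraic] (T : Equations L)

/-- The free algebra in the variety `T` on the generators `X`; it is `F_κ` for `κ = #X`. -/
abbrev FreeAlg (X : Type u) : Type u := Presented T (noEquations (L := L) (X := X))

/-- The equations defining the free product of `A` and `B`. -/
inductive FreeProductRel (A : Type u) (B : Type w) [L.Structure A] [L.Structure B] :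
    L.Term (A ⊕ B) → L.Term (A ⊕ B) → Prop
  | left {s t} : Diagram (A := A) Sum.inl s t → FreeProductRel A B s t
  | right {s t} : Diagram (A := B) Sum.inr s t → FreeProductRel A B s t

/-- The free product `A ∗ B` in the variety `T`. -/
abbrev FreeProduct (A : Type u) (B : Type w) [L.Structure A] [L.Structure B] : Type (max u w) :=
  Presented T (FreeProductRel (L := L) A B)

namespace FreeProduct

variable {A : Type u} {B : Type w} [L.Structure A] [L.Structure B]

/-- The canonical map `A → A ∗ B`. -/
def inl : A →[L] FreeProduct T A B := Presented.ofDiagram Sum.inl fun _ _ h => .left h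

/-- The canonical map `B → A ∗ B`. -/
def inr : B →[L] FreeProduct T A B := Presented.ofDiagram Sum.inr fun _ _ h => .right h

universe u' w'

/-- The canonical map `f ∗ g : A ∗ B → A' ∗ B'`. -/
noncomputable def map {A' : Type u'} {B' : Type w'} [L.Structure A'] [L.Structure B'] (f : A →[L] A')
    (g : B →[L] B') : FreeProduct T A B →[L] FreeProduct T A' B' :=
  Presented.lift (Presented.isModel T _)
    (Sum.elim (fun a => inl T (f a)) (fun b => inr T (g b))) <| by
      rintro _ _ (⟨⟨k, a⟩⟩ | ⟨⟨k, b⟩⟩)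
      · simp only [Term.realize, Sum.elim_inl, Hom.map_fun]
        rfl
      · simp only [Term.realize, Sum.elim_inr, Hom.map_fun]
        rfl

end FreeProduct

universe u₁ u₂ u₃

/-- The equations defining the free product of the `N i` over `M`, where `φ i` is the inclusion of
`M` in `N i`: all the diagrams, and the identification of the copies of `M`. -/
inductive FreeProductOverRel {M : Type u₁} {I : Type u₂} {N : I → Type u₃} [L.Structure M]
    [∀ i, L.Structure (N i)] (φ : ∀ i, M ↪[L] N i) :
    L.Term (M ⊕ Σ i, N i) → L.Term (M ⊕ Σ i, N i) → Prop
  | base {s t} : Diagram (A := M) Sum.inl s t → FreeProductOverRel φ s t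
  | factor {s t} (i : I) :
      Diagram (A := N i) (fun a => Sum.inr ⟨i, a⟩) s t → FreeProductOverRel φ s t
  | glue (i : I) (m : M) :
      FreeProductOverRel φ (Term.var (Sum.inr ⟨i, φ i m⟩)) (Term.var (Sum.inl m))

/-- The free product `∗_M {N i : i ∈ I}` over `M`, in the variety `T`. -/
abbrev FreeProductOver {M : Type u₁} {I : Type u₂} {N : I → Type u₃} [L.Structure M]
    [∀ i, L.Structure (N i)] (φ : ∀ i, M ↪[L] N i) : Type (max u₁ u₂ u₃) :=
  Presented T (FreeProductOverRel φ)

/-- The canonical map `M → ∗_M {N i : i ∈ I}`. -/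
def FreeProductOver.base {M : Type u₁} {I : Type u₂} {N : I → Type u₃} [L.Structure M]
    [∀ i, L.Structure (N i)] (φ : ∀ i, M ↪[L] N i) : M →[L] FreeProductOver T φ :=
  Presented.ofDiagram Sum.inl fun _ _ h => .base h

/-- The free product over `M` of `I` many copies of `N`, for a subalgebra `M` of `N`. -/
abbrev CopiesOver {N : Type u} [L.Structure N] (M : L.Substructure N) (I : Type w) :
    Type (max u w) :=
  FreeProductOver T fun _ : I => M.subtype

end Products

/-! ### Freeness -/

section Freeness

variable (T : Equations L)

/-- `S` is a free basis of the subalgebra it generates: distinct elements of `S` satisfy only the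
equations provable from `T`. -/
def IsFreeBasis {A : Type u} [L.Structure A] (S : Set A) : Prop :=
  ∀ s t : L.Term S, s.realize (fun a : S => (a : A)) = t.realize (fun a : S => (a : A)) →
    Provable T noEquations s t

/-- `A` is free: it is generated by a free basis. -/
def IsFree (A : Type u) [L.Structure A] : Prop :=
  ∃ S : Set A, IsFreeBasis T S ∧ Substructure.closure L S = ⊤

/-- `B / A` is free, where `A` is regarded as a subalgebra of `B` through `φ`: `φ` is injective and
there is a free basis `S` such that `B` is generated by `A ∪ S`, and between the elements of `S` and
`A` only those equations hold that follow from `T` and the diagram of `A`. -/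
def IsFreeOver {A : Type u} {B : Type w} [L.Structure A] [L.Structure B] (φ : A →[L] B) : Prop :=
  Function.Injective φ ∧
    ∃ S : Set B, IsFreeBasis T S ∧
      Substructure.closure L (Set.range φ ∪ S) = ⊤ ∧
      ∀ s t : L.Term (A ⊕ S),
        s.realize (Sum.elim φ (fun b : S => (b : B))) =
            t.realize (Sum.elim φ (fun b : S => (b : B))) →
          Provable T (Diagram (A := A) Sum.inl) s t

/-- `A` is almost free: it is the union of an increasing continuous chain, of length the cofinality
of `#A`, of free subalgebras of size less than `#A`. -/
def IsAlmostFree (A : Type u) [L.Structure A] : Prop :=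
  ∃ C : Ordinal.{u} → L.Substructure A,
    (∀ i j, i ≤ j → j < (#A).ord.cof.ord → C i ≤ C j) ∧
    (∀ i, Order.IsSuccLimit i → i < (#A).ord.cof.ord → (C i : Set A) = ⋃ j < i, (C j : Set A)) ∧
    (∀ i < (#A).ord.cof.ord, IsFree T (C i) ∧ #(C i) < #A) ∧
    ⋃ i < (#A).ord.cof.ord, (C i : Set A) = Set.univ

variable [L.IsAlgebraic]

/-- `A` is essentially free: `A ∗ B` is free for some free algebra `B` in the variety. -/
def IsEssentiallyFree (A : Type u) [L.Structure A] : Prop :=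
  ∃ (B : Type u) (_ : L.Structure B), IsModel T B ∧ IsFree T B ∧ IsFree T (FreeProduct T A B)

/-- The algebra `A` exemplifies `κ ∈ EINC(T)`. -/
structure Exemplifies (κ : Cardinal.{u}) (A : Type u) [L.Structure A] : Prop where
  isModel : IsModel T A
  card_eq : #A = κ
  almostFree : IsAlmostFree T A
  essentiallyFree : IsEssentiallyFree T A
  not_free : ¬ IsFree T A

/-- The essentially free spectrum `EINC(T)`. -/
def EINC : Set Cardinal.{u} :=
  {κ | ∃ (A : Type u) (_ : L.Structure A), Exemplifies T κ A}

/-- The algebra `N` and its subalgebra `M` witness `Pr₁(T)`. -/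
structure WitnessesPrOne (N : Type u) [L.Structure N] (M : L.Substructure N) : Prop where
  isModel : IsModel T N
  countablyGenerated : Structure.CG L N
  base_free : IsFree T M
  /-- `N ∗ F_{ℵ₀} / M` is free. -/
  free_over :
    IsFreeOver T ((FreeProduct.inl T (A := N) (B := FreeAlg T ℕ)).comp M.subtype.toHom)
  /-- `(∗_M {N : n ∈ ω}) ∗ F_{ℵ₀} / M ∗ F_{ℵ₀}` is not free. -/
  not_free_over :
    ¬ IsFreeOver T
      (FreeProduct.map T (FreeProductOver.base T fun _ : ℕ => M.subtype)
        (Hom.id L (FreeAlg T ℕ)))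

/-- The property `Pr₁(T)`. -/
def PrOne : Prop :=
  ∃ (N : Type u) (_ : L.Structure N) (M : L.Substructure N), WitnessesPrOne T N M

end Freeness

end Variety

namespace Variety

open Substructure

universe v v₁

variable {L : FirstOrder.Language.{0, 0}} {T : Equations L}

/-! ### Freeness through extension of homomorphisms -/

/-! Let `P` be the free product over `M` of `λ = μ⁺` copies of `N`, times `F_μ`. Freeness is handled
through universal properties: `FreelyGenerates`, `FreelyGeneratesOver` and `IsAmalgam` say which
homomorphisms out of an algebra may be prescribed, and `provable_of_hom` turns this back into
provability.

The engine is absorption (`IsAmalgam.absorb`). Since `N ∗ F_ω` is free over `M`, a copy of `N`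
together with countably many free generators is just a set of free generators over `M`. With `μ`
generators at hand, any `μ` copies can be absorbed without changing the subalgebra generated. Hence
the span of `M`, of at most `μ` copies and of `F_μ` is free, and these spans filter `P`: it is
almost free. One further free factor with `λ` generators absorbs every copy, so `P` is essentially
free.

Suppose `P` had a basis `B`. Closing off yields a set `X` of at most `μ` copies and `B₀ ⊆ B` such
that `M`, the copies in `X` and `F_μ` generate the same subalgebra as `B₀`. Absorbing `X` turns this
subalgebra into `M ∗ F` with `F` free; over it `P` is free, with basis `B \ B₀`, and is also the
amalgam of the remaining copies. A second, countable closing off reduces this to `ω` copies and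
`F_ω`, contradicting (iii).

The cardinality of `P` is also due to (iii). If `P` were smaller than `λ`, copies would collide, so
homomorphisms on `N` would be determined by `M`. Then the countable amalgam would be generated by `M
∗ F_ω` alone, hence free over it with empty basis. -/

theorem exists_term_of_closure_eq_top {A : Type u} [L.Structure A] {X : Type v} {x : X → A}
    (hx : closure L (Set.range x) = ⊤) (a : A) : ∃ t : L.Term X, t.realize x = a := by
  have ha : a ∈ closure L (Set.range x) := hx ▸ mem_top a
  obtain ⟨t, rfl⟩ := mem_closure_iff_exists_term.1 ha
  refine ⟨t.relabel fun y => y.2.choose, ?_⟩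
  rw [Term.realize_relabel]
  congr 1
  funext y
  exact y.2.choose_spec

theorem exists_hom_of_realize_eq [L.IsAlgebraic] {A : Type u} {C : Type v₁} [L.Structure A]
    [L.Structure C] {X : Type v} {x : X → A} (hx : closure L (Set.range x) = ⊤) (y : X → C)
    (h : ∀ s t : L.Term X, s.realize x = t.realize x → s.realize y = t.realize y) :
    ∃ f : A →[L] C, ∀ i, f (x i) = y i := by
  choose τ hτ using exists_term_of_closure_eq_top hx
  refine ⟨⟨fun a => (τ a).realize y, fun {n} f a => ?_, fun r => isEmptyElim r⟩, fun i =>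
    h (τ (x i)) (Term.var i) (hτ _)⟩
  refine h (τ _) (Term.func f fun i => τ (a i)) ?_
  rw [hτ]
  simp only [Term.realize, hτ]

theorem IsModel.substructure {A : Type u} [L.Structure A] (hA : IsModel T A)
    (D : L.Substructure A) : IsModel T D := by
  intro e he v
  apply D.subtype.injective
  rw [← HomClass.realize_term D.subtype, ← HomClass.realize_term D.subtype]
  exact hA e he _

/-- `A` is generated by the family `x`, and homomorphisms from `A` to algebras in the variety may
be prescribed arbitrarily on `x`. -/
structure FreelyGenerates (T : Equations L) {A : Type u} [L.Structure A] {X : Type v}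
    (x : X → A) : Prop where
  gen : closure L (Set.range x) = ⊤
  ext : ∀ (C : Type u) [L.Structure C], IsModel T C → ∀ s : X → C,
    ∃ h : A →[L] C, ∀ i, h (x i) = s i

/-- `B` is generated by the image of `A` and the family `x`, and homomorphisms from `B` to algebras
in the variety may be prescribed arbitrarily on `A` and on `x`. -/
structure FreelyGeneratesOver (T : Equations L) {A B : Type u} [L.Structure A] [L.Structure B]
    (φ : A →[L] B) {X : Type v} (x : X → B) : Prop where
  gen : closure L (Set.range φ ∪ Set.range x) = ⊤
  ext : ∀ (C : Type u) [L.Structure C], IsModel T C → ∀ (g : A →[L] C) (s : X → C),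
    ∃ h : B →[L] C, (∀ a, h (φ a) = g a) ∧ ∀ i, h (x i) = s i

theorem realize_eq_of_diagram {A : Type u} {C : Type v₁} {X : Type v} [L.Structure A]
    [L.Structure C] (g : A →[L] C) (c : A → X) (y : X → C) (hy : ∀ a, y (c a) = g a)
    {s t : L.Term X} (h : Diagram c s t) : s.realize y = t.realize y := by
  obtain ⟨f, a⟩ := h
  simp only [Term.realize, hy, Hom.map_fun]
  rfl

theorem subst_var {X : Type v} (t : L.Term X) : t.subst Term.var = t := by
  induction t with
  | var => rfl
  | func f ts ih => simp only [Term.subst, ih]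

variable [L.IsAlgebraic]

/-- Equality in a presented algebra is provability, so a homomorphism onto the named generators
carries an equation true in `A` to a derivation. All syntactic conclusions are drawn from universal
properties in this way. -/
theorem provable_of_hom {A : Type v} [L.Structure A] {X : Type u}
    {E : L.Term X → L.Term X → Prop} (f : A →[L] Presented T E) (x : X → A)
    (hf : ∀ i, f (x i) = Presented.gen T E i) {s t : L.Term X} (h : s.realize x = t.realize x) :
    Provable T E s t := by
  have hf' : f ∘ x = fun i => Presented.mk T E (Term.var i) := funext hf
  have := congrArg f h
  rw [← HomClass.realize_term f, ← HomClass.realize_term f, hf', Presented.realize_mk,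
    Presented.realize_mk, Presented.mk_eq_mk] at this
  simpa only [subst_var] using this

theorem FreelyGenerates.isFreeBasis {A : Type u} [L.Structure A] {X : Type v} {x : X → A}
    (h : FreelyGenerates T x) : IsFreeBasis T (Set.range x) := by
  intro s t hst
  obtain ⟨f, hf⟩ := h.ext (FreeAlg T (Set.range x)) (Presented.isModel T _)
    fun i => Presented.gen T _ ⟨x i, i, rfl⟩
  refine provable_of_hom f _ ?_ hst
  rintro ⟨_, i, rfl⟩
  exact hf i

theorem FreelyGenerates.isFree {A : Type u} [L.Structure A] {X : Type v} {x : X → A}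
    (h : FreelyGenerates T x) : IsFree T A :=
  ⟨Set.range x, h.isFreeBasis, h.gen⟩

theorem IsFree.exists_freelyGenerates {A : Type u} [L.Structure A] (h : IsFree T A) :
    ∃ S : Set A, FreelyGenerates T fun a : S => (a : A) := by
  obtain ⟨S, hS, hgen⟩ := h
  have hgen' : closure L (Set.range fun a : S => (a : A)) = ⊤ := by rwa [Subtype.range_coe]
  refine ⟨S, hgen', fun C _ hC y => exists_hom_of_realize_eq hgen' y fun s t hst => ?_⟩
  exact Presented.realize_eq_of_provable hC y (fun _ _ h => h.elim) (hS s t hst)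

theorem IsFreeOver.exists_freelyGeneratesOver {A B : Type u} [L.Structure A] [L.Structure B]
    {φ : A →[L] B} (h : IsFreeOver T φ) :
    ∃ S : Set B, FreelyGeneratesOver T φ fun b : S => (b : B) := by
  obtain ⟨-, S, -, hgen, hrel⟩ := h
  have hgen' : closure L (Set.range φ ∪ Set.range fun a : S => (a : B)) = ⊤ := by
    rwa [Subtype.range_coe]
  refine ⟨S, hgen', fun C _ hC g y => ?_⟩
  obtain ⟨f, hf⟩ := exists_hom_of_realize_eq (x := Sum.elim φ fun b : S => (b : B))
    (by rwa [Set.Sum.elim_range]) (Sum.elim g y) fun s t hst =>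
      Presented.realize_eq_of_provable hC _
        (fun _ _ h => realize_eq_of_diagram g Sum.inl _ (fun _ => rfl) h) (hrel s t hst)
  exact ⟨f, fun a => hf (Sum.inl a), fun i => hf (Sum.inr i)⟩

/-- If `A` maps to every nonempty algebra in the variety, then `B / A` is free as soon as `B` is
freely generated over `A`. -/
theorem FreelyGeneratesOver.isFreeOver {A B : Type u} [L.Structure A] [L.Structure B]
    (hA : IsModel T A)
    (hA' : ∀ (C : Type u) [L.Structure C], IsModel T C → Nonempty C → Nonempty (A →[L] C))
    {φ : A →[L] B} {X : Type v} {x : X → B} (h : FreelyGeneratesOver T φ x) :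
    IsFreeOver T φ := by
  refine ⟨fun a a' haa' => ?_, Set.range x, fun s t hst => ?_, h.gen, fun s t hst => ?_⟩
  -- The identity of `A` extends to `B`, the point `a` serving as value on the basis; so `φ` has a
  -- left inverse.
  · obtain ⟨f, hf, -⟩ := h.ext A hA (Hom.id L A) fun _ => a
    simpa only [hf, Hom.id_apply] using congrArg f haa'
  -- The class of the term `s` shows that this free algebra is nonempty; without constants or
  -- generators it could be empty.
  · obtain ⟨g⟩ := hA' (FreeAlg T (Set.range x)) (Presented.isModel T _) ⟨Presented.mk T _ s⟩
    obtain ⟨f, -, hf⟩ := h.ext (FreeAlg T (Set.range x)) (Presented.isModel T _) g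
      fun i => Presented.gen T _ ⟨x i, i, rfl⟩
    refine provable_of_hom f _ ?_ hst
    rintro ⟨_, i, rfl⟩
    exact hf i
  · obtain ⟨f, hfA, hf⟩ := h.ext
      (Presented T (Diagram (L := L) (A := A) (X := A ⊕ Set.range x) Sum.inl))
      (Presented.isModel T _) (Presented.ofDiagram Sum.inl fun _ _ h => h)
      fun i => Presented.gen T _ (Sum.inr ⟨x i, i, rfl⟩)
    refine provable_of_hom f _ ?_ hst
    rintro (a | ⟨_, i, rfl⟩)
    · exact hfA a
    · exact hf i

end Variety

namespace Variety

open Substructure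

universe v v₁ v₂ v₃ v₄

variable {L : FirstOrder.Language.{0, 0}} {T : Equations L}

/-! ### Amalgams of copies of `N` over `M` and a free algebra -/

/-- The subalgebra generated by the images of `M` and of the copies of `N`, and the family `x`. -/
def amalgamSpan {M N P : Type u} [L.Structure M] [L.Structure N] [L.Structure P]
    {I : Type v₁} {J : Type v₂} (b : M →[L] P) (e : I → N →[L] P) (x : J → P) :
    L.Substructure P :=
  closure L (Set.range b ∪ (⋃ i, Set.range (e i)) ∪ Set.range x)

theorem amalgamSpan_le {M N P : Type u} [L.Structure M] [L.Structure N] [L.Structure P]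
    {I : Type v₁} {J : Type v₂} {b : M →[L] P} {e : I → N →[L] P} {x : J → P}
    {D : L.Substructure P} :
    amalgamSpan b e x ≤ D ↔ (∀ m, b m ∈ D) ∧ (∀ i n, e i n ∈ D) ∧ ∀ j, x j ∈ D := by
  simp only [amalgamSpan, closure_le, Set.union_subset_iff, Set.range_subset_iff,
    Set.iUnion_subset_iff, SetLike.mem_coe, and_assoc]

theorem closure_range_union_le {A B : Type u} [L.Structure A] [L.Structure B] {X : Type v}
    {φ : A →[L] B} {x : X → B} {D : L.Substructure B} :
    closure L (Set.range φ ∪ Set.range x) ≤ D ↔ (∀ a, φ a ∈ D) ∧ ∀ i, x i ∈ D := by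
  simp only [closure_le, Set.union_subset_iff, Set.range_subset_iff, SetLike.mem_coe]

theorem FreelyGeneratesOver.eq_top {A B : Type u} [L.Structure A] [L.Structure B] {X : Type v}
    {φ : A →[L] B} {x : X → B} (h : FreelyGeneratesOver T φ x) {D : L.Substructure B}
    (hφ : ∀ a, φ a ∈ D) (hx : ∀ i, x i ∈ D) (b : B) : b ∈ D :=
  (h.gen ▸ closure_range_union_le.2 ⟨hφ, hx⟩ : (⊤ : L.Substructure B) ≤ D) (mem_top b)

theorem FreelyGeneratesOver.hom_ext {A B : Type u} [L.Structure A] [L.Structure B] {X : Type v}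
    {φ : A →[L] B} {x : X → B} (h : FreelyGeneratesOver T φ x) {C : Type w} [L.Structure C]
    {f g : B →[L] C} (hφ : ∀ a, f (φ a) = g (φ a)) (hx : ∀ i, f (x i) = g (x i)) (b : B) :
    f b = g b :=
  h.eq_top (D := f.eqLocus g) hφ hx b

/-- `P` is the free product over `M` of copies of `N` indexed by `I` and of the free algebra
on `J`: homomorphisms from `P` to algebras in the variety may be prescribed compatibly on these. -/
structure IsAmalgam (T : Equations L) {M N P : Type u} [L.Structure M] [L.Structure N]
    [L.Structure P] (ι : M →[L] N) {I : Type v₁} {J : Type v₂} (b : M →[L] P)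
    (e : I → N →[L] P) (x : J → P) : Prop where
  comm : ∀ i m, e i (ι m) = b m
  gen : amalgamSpan b e x = ⊤
  ext : ∀ (C : Type u) [L.Structure C], IsModel T C → ∀ (g : M →[L] C) (k : I → N →[L] C)
    (s : J → C), (∀ i m, k i (ι m) = g m) →
    ∃ h : P →[L] C, (∀ m, h (b m) = g m) ∧ (∀ i n, h (e i n) = k i n) ∧ ∀ j, h (x j) = s j

/-- Homomorphisms from `M` to nonempty algebras in the variety extend along `ι`. -/
def ExtendsAlong (T : Equations L) {M N : Type u} [L.Structure M] [L.Structure N]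
    (ι : M →[L] N) : Prop :=
  ∀ (C : Type u) [L.Structure C], IsModel T C → Nonempty C → ∀ g : M →[L] C,
    ∃ k : N →[L] C, ∀ m, k (ι m) = g m

/-- Send all the free generators of `W` over `M` to one point of the target and restrict to `N`. -/
theorem ExtendsAlong.of_freelyGeneratesOver {M N W : Type u} [L.Structure M] [L.Structure N]
    [L.Structure W] {ι : M →[L] N} {ε : N →[L] W} {S : Type v} {β : S → W}
    (hS : FreelyGeneratesOver T (ε.comp ι) β) : ExtendsAlong T ι := by
  intro C _ hC ⟨c⟩ g
  obtain ⟨h, hh, -⟩ := hS.ext C hC g fun _ => c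
  exact ⟨h.comp ε, hh⟩

namespace IsAmalgam

variable {M N P : Type u} [L.Structure M] [L.Structure N] [L.Structure P] {ι : M →[L] N}
  {I : Type v₁} {J : Type v₂} {b : M →[L] P} {e : I → N →[L] P} {x : J → P}

theorem eq_top (h : IsAmalgam T ι b e x) {D : L.Substructure P} (hb : ∀ m, b m ∈ D)
    (he : ∀ i n, e i n ∈ D) (hx : ∀ j, x j ∈ D) (p : P) : p ∈ D :=
  (h.gen ▸ amalgamSpan_le.2 ⟨hb, he, hx⟩ : (⊤ : L.Substructure P) ≤ D) (mem_top p)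

theorem hom_ext (h : IsAmalgam T ι b e x) {C : Type w} [L.Structure C] {f g : P →[L] C}
    (hb : ∀ m, f (b m) = g (b m)) (he : ∀ i n, f (e i n) = g (e i n))
    (hx : ∀ j, f (x j) = g (x j)) (p : P) : f p = g p :=
  h.eq_top (D := f.eqLocus g) hb he hx p

theorem reindex (h : IsAmalgam T ι b e x) {I' : Type v₃} {J' : Type v₄} (σ : I' ≃ I)
    (τ : J' ≃ J) : IsAmalgam T ι b (fun i => e (σ i)) (fun j => x (τ j)) where
  comm i := h.comm (σ i)
  gen := by
    rw [eq_top_iff, ← h.gen, amalgamSpan_le]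
    obtain ⟨h₁, h₂, h₃⟩ := amalgamSpan_le.1
      (le_refl (amalgamSpan b (fun i => e (σ i)) fun j => x (τ j)))
    exact ⟨h₁, fun i n => by simpa using h₂ (σ.symm i) n, fun j => by simpa using h₃ (τ.symm j)⟩
  ext C _ hC g k s hk := by
    obtain ⟨f, h₁, h₂, h₃⟩ := h.ext C hC g (fun i => k (σ.symm i)) (fun j => s (τ.symm j))
      fun i => hk _
    exact ⟨f, h₁, fun i n => by simpa using h₂ (σ i) n, fun j => by simpa using h₃ (τ j)⟩

theorem freelyGeneratesOver [IsEmpty I] (h : IsAmalgam T ι b e x) :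
    FreelyGeneratesOver T b x where
  gen := by
    rw [eq_top_iff, ← h.gen, amalgamSpan_le]
    obtain ⟨h₁, h₂⟩ := closure_range_union_le.1 (le_refl (closure L (Set.range b ∪ Set.range x)))
    exact ⟨h₁, isEmptyElim, h₂⟩
  ext C _ hC g s := by
    obtain ⟨f, h₁, -, h₃⟩ := h.ext C hC g isEmptyElim s isEmptyElim
    exact ⟨f, h₁, h₃⟩

theorem adjoin (h : IsAmalgam T ι b e x) {Q : Type u} [L.Structure Q] {φ : P →[L] Q}
    {Z : Type v₃} {z : Z → Q} (hz : FreelyGeneratesOver T φ z) :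
    IsAmalgam T ι (φ.comp b) (fun i => φ.comp (e i)) (Sum.elim (φ ∘ x) z) where
  comm i m := congrArg φ (h.comm i m)
  gen := by
    obtain ⟨h₁, h₂, h₃⟩ := amalgamSpan_le.1
      (le_refl (amalgamSpan (φ.comp b) (fun i => φ.comp (e i)) (Sum.elim (φ ∘ x) z)))
    refine eq_top_iff.2 fun q _ => hz.eq_top ?_ (fun i => h₃ (Sum.inr i)) q
    exact fun p => h.eq_top (D := Substructure.comap φ
      (amalgamSpan (φ.comp b) (fun i => φ.comp (e i)) (Sum.elim (φ ∘ x) z))) h₁ h₂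
      (fun j => h₃ (Sum.inl j)) p
  ext C _ hC g k s hk := by
    obtain ⟨f, h₁, h₂, h₃⟩ := h.ext C hC g k (fun j => s (Sum.inl j)) hk
    obtain ⟨f', h₁', h₂'⟩ := hz.ext C hC f fun i => s (Sum.inr i)
    refine ⟨f', fun m => (h₁' _).trans (h₁ m), fun i n => (h₁' _).trans (h₂ i n), ?_⟩
    rintro (j | i)
    · exact (h₁' _).trans (h₃ j)
    · exact h₂' i

/-- A part of the amalgam is again an amalgam, since `N` maps over `M` to every nonempty algebra
to which `M` maps. -/
theorem sub (h : IsAmalgam T ι b e x) (hι : ExtendsAlong T ι) {I' : Type v₃} {J' : Type v₄}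
    [Nonempty J'] {σ : I' → I} (hσ : σ.Injective) {u : J' → J} (hu : u.Injective)
    {D : L.Substructure P} (hD : D = amalgamSpan b (e ∘ σ) (x ∘ u)) {b' : M →[L] D}
    {e' : I' → N →[L] D} {x' : J' → D} (hb : ∀ m, (b' m : P) = b m)
    (he : ∀ i n, (e' i n : P) = e (σ i) n) (hx : ∀ j, (x' j : P) = x (u j)) :
    IsAmalgam T ι b' e' x' where
  comm i m := Subtype.ext <| by rw [he, hb, h.comm]
  gen := by
    obtain ⟨h₁, h₂, h₃⟩ := amalgamSpan_le.1 (le_refl (amalgamSpan b' e' x'))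
    have key : D ≤ (amalgamSpan b' e' x').map D.subtype.toHom := by
      conv_lhs => rw [hD]
      exact amalgamSpan_le.2 ⟨fun m => ⟨_, h₁ m, hb m⟩, fun i n => ⟨_, h₂ i n, he i n⟩,
        fun j => ⟨_, h₃ j, hx j⟩⟩
    refine eq_top_iff.2 fun d _ => ?_
    obtain ⟨d', hd', hdd'⟩ := key d.2
    rwa [← show d' = d from Subtype.ext hdd']
  ext C _ hC g k s hk := by
    -- `Nonempty J'` is needed to have a point of `C`. The omitted copies of `N` are mapped by one
    -- extension `k₀` of `g`, the omitted generators to `c`.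
    have c : C := s (Classical.arbitrary J')
    obtain ⟨k₀, hk₀⟩ := hι C hC ⟨c⟩ g
    obtain ⟨f, h₁, h₂, h₃⟩ := h.ext C hC g (Function.extend σ k fun _ => k₀)
      (Function.extend u s fun _ => c) fun i m => by
        by_cases hi : ∃ i', σ i' = i
        · obtain ⟨i', rfl⟩ := hi
          rw [hσ.extend_apply, hk]
        · rw [Function.extend_apply' _ _ _ hi, hk₀]
    refine ⟨f.comp D.subtype.toHom, fun m => ?_, fun i n => ?_, fun j => ?_⟩
    · exact (congrArg f (hb m)).trans (h₁ m)
    · exact (congrArg f (he i n)).trans ((h₂ _ n).trans (by rw [hσ.extend_apply]))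
    · exact (congrArg f (hx j)).trans ((h₃ _).trans (hu.extend_apply _ _ _))

/-- If `N ∗ F_Γ` is freely generated by `S` over `M`, then the copies of `N` indexed by a set `X`
together with `Γ` many free generators for each of them may be traded for free generators. -/
theorem absorb (h : IsAmalgam T ι b e x) (hP : IsModel T P) {W : Type u} [L.Structure W]
    {ε : N →[L] W} {Γ : Type v₃} {y : Γ → W} (hW : FreelyGeneratesOver T ε y) {S : Type v₄}
    {β : S → W} (hS : FreelyGeneratesOver T (ε.comp ι) β) (X : Set I) {J₁ : Type w}
    (τ : J ≃ J₁ ⊕ X × Γ) :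
    ∃ x' : J₁ ⊕ X × S → P, IsAmalgam T ι b (fun i : ↥Xᶜ => e i) x' ∧
      closure L (Set.range b ∪ Set.range x') = amalgamSpan b (fun i : X => e i) x := by
  classical
  have hι := ExtendsAlong.of_freelyGeneratesOver hS
  -- `ω i` maps `W` to `P`, as `e i` on `N` and onto the block of generators that `τ` reserves for
  -- the copy `i`.
  choose ω hωe hωy using fun i : X =>
    hW.ext P hP (e i) fun γ => x (τ.symm (Sum.inr (i, γ)))
  have hω (D : L.Substructure P) (i : X) (hb : ∀ m, b m ∈ D) (hs : ∀ s, ω i (β s) ∈ D)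
      (a : W) : ω i a ∈ D :=
    hS.eq_top (D := Substructure.comap (ω i) D)
      (fun m => by
        rw [Substructure.mem_comap, Hom.comp_apply, hωe, h.comm]
        exact hb m) hs a
  -- The unreserved generators are kept; each absorbed copy and its block are replaced by the image
  -- of the basis of `W` over `M`.
  let x' : J₁ ⊕ X × S → P :=
    Sum.elim (fun j => x (τ.symm (Sum.inl j))) fun p => ω p.1 (β p.2)
  have hspan : closure L (Set.range b ∪ Set.range x') = amalgamSpan b (fun i : X => e i) x := by
    apply le_antisymm
    · obtain ⟨h₁, h₂, h₃⟩ := amalgamSpan_le.1 (le_refl (amalgamSpan b (fun i : X => e i) x))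
      refine closure_range_union_le.2 ⟨h₁, ?_⟩
      rintro (j | ⟨i, s⟩)
      · exact h₃ _
      · refine hW.eq_top (D := Substructure.comap (ω i) (amalgamSpan b (fun i : X => e i) x))
          (fun n => ?_) (fun γ => ?_) (β s)
        · rw [Substructure.mem_comap, hωe]
          exact h₂ i n
        · rw [Substructure.mem_comap, hωy]
          exact h₃ _
    · obtain ⟨h₁, h₂⟩ := closure_range_union_le.1
        (le_refl (closure L (Set.range b ∪ Set.range x')))
      have hω' (i a) := hω _ i h₁ (fun s => h₂ (Sum.inr (i, s))) a
      refine amalgamSpan_le.2 ⟨h₁, fun i n => ?_, fun j => ?_⟩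
      · rw [← hωe]
        exact hω' i _
      · obtain ⟨j | ⟨i, γ⟩, rfl⟩ := τ.symm.surjective j
        · exact h₂ (Sum.inl j)
        · rw [← hωy]
          exact hω' i _
  refine ⟨x', ⟨fun i => h.comm i, ?_, ?_⟩, hspan⟩
  · obtain ⟨h₁, h₂, h₃⟩ := amalgamSpan_le.1 (le_refl (amalgamSpan b (fun i : ↥Xᶜ => e i) x'))
    have hle := closure_range_union_le.2 ⟨h₁, h₃⟩
    rw [hspan] at hle
    obtain ⟨-, h₄, h₅⟩ := amalgamSpan_le.1 hle
    refine eq_top_iff.2 fun p _ => h.eq_top h₁ (fun i n => ?_) h₅ p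
    by_cases hi : i ∈ X
    · exact h₄ ⟨i, hi⟩ n
    · exact h₂ ⟨i, hi⟩ n
  · intro C _ hC g k s hk
    -- `η i` realizes the prescribed values on the new generators of block `i`; it dictates where
    -- the old copy `i` and its reserved generators must go.
    choose η hηM hηS using fun i : X => hS.ext C hC g fun σ => s (Sum.inr (i, σ))
    obtain ⟨f, h₁, h₂, h₃⟩ := h.ext C hC g
      (fun i => if hi : i ∈ X then (η ⟨i, hi⟩).comp ε else k ⟨i, hi⟩)
      (fun j => Sum.elim (fun j => s (Sum.inl j)) (fun p => η p.1 (y p.2)) (τ j)) fun i m => by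
        split_ifs
        exacts [hηM _ _, hk _ _]
    refine ⟨f, h₁, fun i n => ?_, ?_⟩
    · rw [h₂, dif_neg i.2]
    rintro (j | ⟨i, σ⟩)
    · exact (h₃ _).trans (by simp)
    · refine Eq.trans ?_ (hηS i σ)
      -- `f ∘ ω i` and `η i` agree on `N` and on the old free generators `y`, hence on all of `W`,
      -- in particular on its other basis.
      refine hW.hom_ext (f := f.comp (ω i)) (g := η i) (fun n => ?_) (fun γ => ?_) (β σ)
      · rw [Hom.comp_apply, hωe, h₂, dif_pos i.2]
        rfl
      · rw [Hom.comp_apply, hωy, h₃]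
        simp

end IsAmalgam

theorem FreelyGeneratesOver.sub {A B : Type u} [L.Structure A] [L.Structure B] {X : Type v}
    {φ : A →[L] B} {x : X → B} (h : FreelyGeneratesOver T φ x) {Y : Type w} [Nonempty Y]
    {u : Y → X} (hu : u.Injective)
    {D : L.Substructure B} (hD : D = closure L (Set.range φ ∪ Set.range (x ∘ u)))
    {φ' : A →[L] D} {x' : Y → D} (hφ : ∀ a, (φ' a : B) = φ a) (hx : ∀ i, (x' i : B) = x (u i)) :
    FreelyGeneratesOver T φ' x' where
  gen := by
    obtain ⟨h₁, h₂⟩ := closure_range_union_le.1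
      (le_refl (closure L (Set.range φ' ∪ Set.range x')))
    have key : D ≤ (closure L (Set.range φ' ∪ Set.range x')).map D.subtype.toHom := by
      conv_lhs => rw [hD]
      exact closure_range_union_le.2 ⟨fun m => ⟨_, h₁ m, hφ m⟩, fun i => ⟨_, h₂ i, hx i⟩⟩
    refine eq_top_iff.2 fun d _ => ?_
    obtain ⟨d', hd', hdd'⟩ := key d.2
    rwa [← show d' = d from Subtype.ext hdd']
  ext C _ hC g s := by
    obtain ⟨f, h₁, h₂⟩ := h.ext C hC g (Function.extend u s fun _ => s (Classical.arbitrary Y))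
    refine ⟨f.comp D.subtype.toHom, fun a => (congrArg f (hφ a)).trans (h₁ a), fun i => ?_⟩
    exact (congrArg f (hx i)).trans ((h₂ _).trans (hu.extend_apply _ _ _))

theorem FreelyGeneratesOver.freelyGenerates {A B : Type u} [L.Structure A] [L.Structure B]
    {X : Type v} {φ : A →[L] B} {x : X → B} (h : FreelyGeneratesOver T φ x) {Y : Type w}
    {y : Y → A} (hy : FreelyGenerates T y) : FreelyGenerates T (Sum.elim (φ ∘ y) x) where
  gen := by
    refine eq_top_iff.2 fun b _ => h.eq_top (fun a => ?_)
      (fun i => Substructure.subset_closure (Set.mem_range_self (Sum.inr i))) b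
    have : closure L (Set.range y) ≤
        (closure L (Set.range (Sum.elim (φ ∘ y) x))).comap φ := by
      rw [closure_le, Set.range_subset_iff]
      exact fun j => Substructure.subset_closure (Set.mem_range_self (Sum.inl j))
    exact this (hy.gen ▸ mem_top a)
  ext C _ hC s := by
    obtain ⟨g, hg⟩ := hy.ext C hC fun j => s (Sum.inl j)
    obtain ⟨f, h₁, h₂⟩ := h.ext C hC g fun i => s (Sum.inr i)
    refine ⟨f, ?_⟩
    rintro (j | i)
    exacts [(h₁ _).trans (hg j), h₂ i]

/-! ### The amalgams presented by generators and equations -/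

variable [L.IsAlgebraic]

/-- The universes are separated so that the same statement serves `ℕ` and the index sets in `Type
u`. -/
theorem freelyGeneratesOver_inl {A : Type (max u w)} [L.Structure A] {X : Type w} :
    FreelyGeneratesOver.{max u w, w} T (FreeProduct.inl T (A := A) (B := FreeAlg T X))
      (fun i => FreeProduct.inr T (Presented.gen T _ i)) where
  gen := by
    obtain ⟨h₁, h₂⟩ := closure_range_union_le.1 (le_refl (closure L
      (Set.range (FreeProduct.inl T (A := A) (B := FreeAlg T X)) ∪
        Set.range (fun i : X => FreeProduct.inr T (Presented.gen T _ i)))))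
    have h₃ (c : FreeAlg T X) : FreeProduct.inr T (A := A) c ∈ closure L
        (Set.range (FreeProduct.inl T (A := A) (B := FreeAlg T X)) ∪
          Set.range (fun i : X => FreeProduct.inr T (Presented.gen T _ i))) := by
      obtain ⟨t, rfl⟩ := Presented.mk_surjective c
      induction t with
      | var i => exact h₂ i
      | func f ts ih =>
        rw [← Presented.funMap_mk, Hom.map_fun]
        exact Substructure.fun_mem _ f _ ih
    refine eq_top_iff.2 fun c hc => ?_
    clear hc
    obtain ⟨t, rfl⟩ := Presented.mk_surjective c
    induction t with
    | var i =>
      obtain a | c := i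
      exacts [h₁ a, h₃ c]
    | func f ts ih =>
      rw [← Presented.funMap_mk]
      exact Substructure.fun_mem _ f _ ih
  ext C _ hC g s := by
    refine ⟨Presented.lift hC (Sum.elim g (Presented.lift hC s fun _ _ h => h.elim)) ?_,
      fun a => rfl, fun i => rfl⟩
    rintro _ _ (h | h)
    · exact realize_eq_of_diagram g Sum.inl _ (fun _ => rfl) h
    · exact realize_eq_of_diagram (Presented.lift hC s fun _ _ h => h.elim) Sum.inr _
        (fun _ => rfl) h

/-- The canonical map of a factor to the free product over `M`. -/
def FreeProductOver.factor {M : Type v₁} {I : Type v₂} {N : I → Type v₃} [L.Structure M]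
    [∀ i, L.Structure (N i)] (φ : ∀ i, M ↪[L] N i) (i : I) : N i →[L] FreeProductOver T φ :=
  Presented.ofDiagram (fun a => Sum.inr ⟨i, a⟩) fun _ _ h => .factor i h

theorem isAmalgam_copiesOver {N : Type (max u w)} [L.Structure N] (M : L.Substructure N)
    (I : Type w) :
    IsAmalgam.{max u w} T M.subtype.toHom (FreeProductOver.base T fun _ : I => M.subtype)
      (FreeProductOver.factor (T := T) fun _ : I => M.subtype) (PEmpty.elim : PEmpty.{1} → _) where
  comm i m := Presented.mk_eq_mk.2 (Provable.hyp (FreeProductOverRel.glue i m))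
  gen := by
    obtain ⟨h₁, h₂, -⟩ := amalgamSpan_le.1 (le_refl (amalgamSpan
      (FreeProductOver.base T fun _ : I => M.subtype)
      (FreeProductOver.factor (T := T) fun _ : I => M.subtype) (PEmpty.elim : PEmpty.{1} → _)))
    refine eq_top_iff.2 fun c hc => ?_
    clear hc
    obtain ⟨t, rfl⟩ := Presented.mk_surjective c
    induction t with
    | var i =>
      obtain m | ⟨i, n⟩ := i
      exacts [h₁ m, h₂ i n]
    | func f ts ih =>
      rw [← Presented.funMap_mk]
      exact Substructure.fun_mem _ f _ ih
  ext C _ hC g k s hk := by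
    refine ⟨Presented.lift hC (Sum.elim g fun p => k p.1 p.2) ?_, fun m => rfl, fun i n => rfl,
      fun j => j.elim⟩
    rintro _ _ (h | ⟨i, h⟩ | ⟨i, m⟩)
    · exact realize_eq_of_diagram g Sum.inl _ (fun _ => rfl) h
    · exact realize_eq_of_diagram (k i) (fun a => Sum.inr ⟨i, a⟩) _ (fun _ => rfl) h
    · exact hk i m

end Variety

namespace Variety

open Substructure Cardinal

universe v₁

variable {L : FirstOrder.Language.{0, 0}} {T : Equations L}

/-! ### Cardinalities and closing off -/

theorem mk_biUnion_le_of_le {α ι : Type u} {κ : Cardinal.{u}} (hκ : ℵ₀ ≤ κ) {s : Set ι}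
    {f : ι → Set α} (hs : #s ≤ κ) (hf : ∀ i ∈ s, #(f i) ≤ κ) : #(⋃ i ∈ s, f i) ≤ κ :=
  (mk_biUnion_le f s).trans <| (mul_le_mul' hs (ciSup_le' fun i : s => hf i.1 i.2)).trans
    (mul_eq_self hκ).le

theorem mk_union_le_of_le {α : Type u} {κ : Cardinal.{u}} (hκ : ℵ₀ ≤ κ) {s t : Set α}
    (hs : #s ≤ κ) (ht : #t ≤ κ) : #(s ∪ t : Set α) ≤ κ :=
  (mk_union_le s t).trans ((add_le_add hs ht).trans (add_eq_self hκ).le)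

theorem mk_closure_le [Countable (Σ n, L.Functions n)] {A : Type u} [L.Structure A]
    {κ : Cardinal.{u}} (hκ : ℵ₀ ≤ κ) {s : Set A} (hs : #s ≤ κ) : #(closure L s) ≤ κ := by
  have h := Substructure.lift_card_closure_le (L := L) (s := s)
  rw [lift_uzero, lift_uzero] at h
  refine h.trans (max_le hκ ((add_le_add ?_ ?_).trans (add_eq_self hκ).le))
  · simpa using hs
  · exact (Cardinal.lift_le_aleph0.2 (mk_le_aleph0_iff.2 inferInstance)).trans hκ

theorem mk_amalgamSpan_le [Countable (Σ n, L.Functions n)] {M N P : Type u} [L.Structure M]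
    [L.Structure N] [L.Structure P] {I J : Type u} (b : M →[L] P) (e : I → N →[L] P) (x : J → P)
    {κ : Cardinal.{u}} (hκ : ℵ₀ ≤ κ) (hM : #M ≤ κ) (hN : #N ≤ κ) (hI : #I ≤ κ) (hJ : #J ≤ κ) :
    #(amalgamSpan b e x) ≤ κ := by
  refine mk_closure_le hκ (mk_union_le_of_le hκ (mk_union_le_of_le hκ ?_ ?_) ?_)
  · exact mk_range_le.trans hM
  · rw [← Set.biUnion_univ]
    exact mk_biUnion_le_of_le hκ (by rwa [mk_univ]) fun i _ => mk_range_le.trans hN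
  · exact mk_range_le.trans hJ

theorem exists_finset_mem_closure {A : Type u} [L.Structure A] {Θ : Type v₁} {G : Θ → Set A}
    {a : A} (ha : a ∈ closure L (⋃ θ, G θ)) :
    ∃ F : Finset Θ, a ∈ closure L (⋃ θ ∈ F, G θ) := by
  classical
  refine closure_induction (p := fun a => ∃ F : Finset Θ, a ∈ closure L (⋃ θ ∈ F, G θ)) ha
    (fun a ha => ?_) fun {n} f y hy => ?_
  · obtain ⟨θ, hθ⟩ := Set.mem_iUnion.1 ha
    exact ⟨{θ}, Substructure.subset_closure (by simpa using hθ)⟩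
  · choose F hF using hy
    refine ⟨Finset.univ.biUnion F, Substructure.fun_mem _ f _ fun i => ?_⟩
    exact closure_mono (Set.biUnion_subset_biUnion_left
      (Finset.subset_biUnion_of_mem F (Finset.mem_univ i))) (hF i)

/-- If two families of small sets generate `A`, then small sets of indices may be enlarged so that
the corresponding parts of both families generate the same subalgebra. -/
theorem exists_closure_eq_closure {A Θ : Type u} [L.Structure A] {G H : Θ → Set A}
    {κ : Cardinal.{u}} (hκ : ℵ₀ ≤ κ) (hG : ∀ θ, #(G θ) ≤ κ) (hH : ∀ θ, #(H θ) ≤ κ)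
    (hG' : closure L (⋃ θ, G θ) = ⊤) (hH' : closure L (⋃ θ, H θ) = ⊤) {Θ₀ : Set Θ}
    (hΘ₀ : #Θ₀ ≤ κ) :
    ∃ Θ₁ : Set Θ, Θ₀ ⊆ Θ₁ ∧ #Θ₁ ≤ κ ∧
      closure L (⋃ θ ∈ Θ₁, G θ) = closure L (⋃ θ ∈ Θ₁, H θ) := by
  classical
  choose F hF using fun a : A => exists_finset_mem_closure (L := L) (G := G) (hG' ▸ mem_top a)
  choose E hE using fun a : A => exists_finset_mem_closure (L := L) (G := H) (hH' ▸ mem_top a)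
  -- Each element of a `G θ` or `H θ` already present receives the finitely many indices needed to
  -- generate it from either family; `ω` iterations close off.
  let step : Set Θ → Set Θ := fun Ξ =>
    Ξ ∪ ⋃ a ∈ ⋃ θ ∈ Ξ, (G θ ∪ H θ), ((F a ∪ E a : Finset Θ) : Set Θ)
  let Ξ : ℕ → Set Θ := fun n => step^[n] Θ₀
  have hsucc (n) : Ξ (n + 1) = step (Ξ n) := Function.iterate_succ_apply' step n Θ₀
  have hcard (n) : #(Ξ n) ≤ κ := by
    induction n with
    | zero => exact hΘ₀
    | succ n ih =>
      rw [hsucc]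
      refine mk_union_le_of_le hκ ih (mk_biUnion_le_of_le hκ (mk_biUnion_le_of_le hκ ih
        fun θ _ => mk_union_le_of_le hκ (hG θ) (hH θ)) fun a _ => ?_)
      exact (Finset.countable_toSet _).le_aleph0.trans hκ
  have hstep {n θ a} (hθ : θ ∈ Ξ n) (ha : a ∈ G θ ∪ H θ) :
      ((F a ∪ E a : Finset Θ) : Set Θ) ⊆ ⋃ n, Ξ n := by
    refine Set.Subset.trans ?_ (Set.subset_iUnion Ξ (n + 1))
    rw [hsucc]
    refine Set.Subset.trans ?_ Set.subset_union_right
    exact Set.subset_biUnion_of_mem (u := fun a => ((F a ∪ E a : Finset Θ) : Set Θ))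
      (Set.mem_biUnion hθ ha)
  refine ⟨⋃ n, Ξ n, Set.subset_iUnion Ξ 0, ?_, le_antisymm ?_ ?_⟩
  · have h := mk_iUnion_le_lift Ξ
    simp only [lift_uzero, mk_nat, lift_aleph0] at h
    exact h.trans ((mul_le_mul' hκ (ciSup_le' hcard)).trans (mul_eq_self hκ).le)
  · rw [closure_le]
    refine Set.iUnion₂_subset fun θ hθ a ha => ?_
    obtain ⟨n, hn⟩ := Set.mem_iUnion.1 hθ
    refine closure_mono (Set.biUnion_subset_biUnion_left (Set.Subset.trans ?_
      (hstep hn (Or.inl ha)))) (hE a)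
    exact fun i hi => Finset.mem_coe.2 (Finset.mem_union_right _ hi)
  · rw [closure_le]
    refine Set.iUnion₂_subset fun θ hθ a ha => ?_
    obtain ⟨n, hn⟩ := Set.mem_iUnion.1 hθ
    refine closure_mono (Set.biUnion_subset_biUnion_left (Set.Subset.trans ?_
      (hstep hn (Or.inr ha)))) (hF a)
    exact fun i hi => Finset.mem_coe.2 (Finset.mem_union_left _ hi)

end Variety

namespace Variety

open Substructure Cardinal

universe v₁ v₂ v₃ v₄

variable {L : FirstOrder.Language.{0, 0}} {T : Equations L}

/-! ### Comparing amalgams with free extensions -/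

/-- If one amalgam of `I` copies of `N` and a free algebra on `J` is free over the part generated
by `M` and `J`, then so is every other. -/
theorem IsAmalgam.freelyGeneratesOver_of_equiv {M N A Q R : Type u} [L.Structure M] [L.Structure N]
    [L.Structure A] [L.Structure Q] [L.Structure R] {ι : M →[L] N} {I : Type v₁} {J : Type v₂}
    {bQ : M →[L] Q} {eQ : I → N →[L] Q} {xQ : J → Q} {bR : M →[L] R} {eR : I → N →[L] R}
    {xR : J → R} (hQ : IsAmalgam T ι bQ eQ xQ) (hR : IsAmalgam T ι bR eR xR)
    (hQT : IsModel T Q) (hRT : IsModel T R) {a : M →[L] A} {xA : J → A}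
    (hA : FreelyGeneratesOver T a xA) {φ : A →[L] R} (hφa : ∀ m, φ (a m) = bR m)
    (hφx : ∀ j, φ (xA j) = xR j) {Z : Type v₃} {z : Z → Q}
    (hz : FreelyGeneratesOver T bQ (Sum.elim xQ z)) :
    ∃ z' : Z → R, FreelyGeneratesOver T φ z' := by
  -- The two universal properties give mutually inverse homomorphisms, along which the basis `z` is
  -- transported.
  obtain ⟨f, hfb, hfe, hfx⟩ := hR.ext Q hQT bQ eQ xQ hQ.comm
  obtain ⟨f', hfb', hfe', hfx'⟩ := hQ.ext R hRT bR eR xR hR.comm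
  have hff' (q) : f (f' q) = q :=
    hQ.hom_ext (f := f.comp f') (g := Hom.id L Q) (by simp [hfb, hfb']) (by simp [hfe, hfe'])
      (by simp [hfx, hfx']) q
  have hf'f (r) : f' (f r) = r :=
    hR.hom_ext (f := f'.comp f) (g := Hom.id L R) (by simp [hfb, hfb']) (by simp [hfe, hfe'])
      (by simp [hfx, hfx']) r
  refine ⟨f' ∘ z, ?_, fun C _ hC g s => ?_⟩
  · obtain ⟨h₁, h₂⟩ := closure_range_union_le.1
      (le_refl (closure L (Set.range φ ∪ Set.range (f' ∘ z))))
    refine eq_top_iff.2 fun r _ => ?_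
    rw [← hf'f r]
    refine hz.eq_top (D := Substructure.comap f' (closure L (Set.range φ ∪ Set.range (f' ∘ z))))
      (fun m => ?_) ?_ (f r)
    · rw [Substructure.mem_comap, hfb', ← hφa]
      exact h₁ _
    · rintro (j | i)
      · rw [Substructure.mem_comap, Sum.elim_inl, hfx', ← hφx]
        exact h₁ _
      · exact h₂ i
  · obtain ⟨k, hk₁, hk₂⟩ := hz.ext C hC (g.comp a) (Sum.elim (fun j => g (xA j)) s)
    refine ⟨k.comp f, fun c => ?_, fun i => ?_⟩
    · refine hA.hom_ext (f := (k.comp f).comp φ) (g := g) (fun m => ?_) (fun j => ?_) c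
      · simp only [Hom.comp_apply, hφa, hfb, hk₁]
      · simp only [Hom.comp_apply, hφx, hfx]
        exact hk₂ (Sum.inl j)
    · simp only [Hom.comp_apply, Function.comp_apply, hff']
      exact hk₂ (Sum.inr i)

/-- If homomorphisms from `N` are determined by their restrictions to `M`, then the amalgam is
free over the part generated by `M` and `J`, with an empty basis. -/
theorem IsAmalgam.freelyGeneratesOver_of_epi {M N A R : Type u} [L.Structure M] [L.Structure N]
    [L.Structure A] [L.Structure R] {ι : M →[L] N} {I : Type v₁} {J : Type v₂} [Nonempty J]
    {b : M →[L] R} {e : I → N →[L] R} {x : J → R} (h : IsAmalgam T ι b e x) (hR : IsModel T R)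
    (hι : ExtendsAlong T ι) {a : M →[L] A} {xA : J → A} (hA : FreelyGeneratesOver T a xA)
    {φ : A →[L] R} (hφa : ∀ m, φ (a m) = b m) (hφx : ∀ j, φ (xA j) = x j)
    (hepi : ∀ (C : Type u) [L.Structure C], IsModel T C → ∀ f f' : N →[L] C,
      (∀ m, f (ι m) = f' (ι m)) → ∀ n, f n = f' n) :
    FreelyGeneratesOver T φ (PEmpty.elim : PEmpty.{1} → R) where
  gen := by
    obtain ⟨h₁, -⟩ := closure_range_union_le.1
      (le_refl (closure L (Set.range φ ∪ Set.range (PEmpty.elim : PEmpty.{1} → R))))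
    have hb (m) : b m ∈ closure L (Set.range φ ∪ Set.range (PEmpty.elim : PEmpty.{1} → R)) := by
      rw [← hφa]
      exact h₁ _
    -- `N` maps over `M` into the subalgebra generated by the image of `φ`. By `hepi` this map
    -- coincides with every `e i`, so all the copies lie in that subalgebra.
    obtain ⟨k, hk⟩ := hι _ (hR.substructure
      (closure L (Set.range φ ∪ Set.range (PEmpty.elim : PEmpty.{1} → R))))
      ⟨⟨_, h₁ (xA (Classical.arbitrary J))⟩⟩ (b.codRestrict _ hb)
    refine eq_top_iff.2 fun r _ => h.eq_top hb (fun i n => ?_) (fun j => ?_) r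
    · rw [hepi R hR (e i) ((Substructure.subtype _).toHom.comp k) (fun m => ?_) n]
      · exact (k n).2
      · rw [h.comm]
        exact (congrArg Subtype.val (hk m)).symm
    · rw [← hφx]
      exact h₁ _
  ext C _ hC g s := by
    obtain ⟨k, hk⟩ := hι C hC ⟨g (xA (Classical.arbitrary J))⟩ (g.comp a)
    obtain ⟨f, h₁, -, h₃⟩ := h.ext C hC (g.comp a) (fun _ => k) (fun j => g (xA j)) fun _ => hk
    refine ⟨f, fun c => ?_, fun i => i.elim⟩
    refine hA.hom_ext (f := f.comp φ) (g := g) (fun m => ?_) (fun j => ?_) c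
    · simp only [Hom.comp_apply, hφa, h₁]
    · simp only [Hom.comp_apply, hφx, h₃]

/-- If `β` freely generates `P`, the family `x` is independent over `M`, and a part of `β` generates
the same subalgebra as `M` and `x`, then `P` is freely generated over `M` by `x` and the rest
of `β`. -/
theorem FreelyGenerates.freelyGeneratesOver_compl {M P : Type u} [L.Structure M] [L.Structure P]
    {B : Type v₁} {β : B → P} (hβ : FreelyGenerates T β) {B₀ : Set B} {b : M →[L] P} {J : Type v₂}
    {x : J → P} (hspan : closure L (Set.range b ∪ Set.range x) = closure L (β '' B₀))
    (hx : ∀ (C : Type u) [L.Structure C], IsModel T C → ∀ (g : M →[L] C) (s : J → C),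
      ∃ h : P →[L] C, (∀ m, h (b m) = g m) ∧ ∀ j, h (x j) = s j) :
    FreelyGeneratesOver T b (Sum.elim x fun i : ↥B₀ᶜ => β i) where
  gen := by
    obtain ⟨h₁, h₂⟩ := closure_range_union_le.1
      (le_refl (closure L (Set.range b ∪ Set.range (Sum.elim x fun i : ↥B₀ᶜ => β i))))
    have h₃ := closure_range_union_le.2 ⟨h₁, fun j => h₂ (Sum.inl j)⟩
    have h₃' : closure L (Set.range b ∪ Set.range x) ≤ _ := h₃
    rw [hspan, closure_le, Set.image_subset_iff] at h₃'
    rw [eq_top_iff, ← hβ.gen, closure_le, Set.range_subset_iff]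
    intro i
    by_cases hi : i ∈ B₀
    · exact h₃' hi
    · exact h₂ (Sum.inr ⟨i, hi⟩)
  ext C _ hC g s := by
    classical
    obtain ⟨f, hfb, hfx⟩ := hx C hC g fun j => s (Sum.inl j)
    -- Follow `f` on `B₀`, so that `k` and `f` agree on the span of `M` and `x`, and take the
    -- prescribed values off `B₀`.
    obtain ⟨k, hk⟩ := hβ.ext C hC fun i => if hi : i ∈ B₀ then f (β i) else s (Sum.inr ⟨i, hi⟩)
    have hkf : closure L (Set.range b ∪ Set.range x) ≤ k.eqLocus f := by
      rw [hspan, closure_le, Set.image_subset_iff]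
      intro i hi
      exact (hk i).trans (dif_pos hi)
    obtain ⟨h₁, h₂⟩ := closure_range_union_le.1 hkf
    refine ⟨k, fun m => (h₁ m).trans (hfb m), ?_⟩
    rintro (j | i)
    · exact (h₂ j).trans (hfx j)
    · exact (hk i).trans (dif_neg i.2)

/-! ### Free amalgams and the two closing off arguments -/

theorem IsAmalgam.isFree [L.IsAlgebraic] {M N P W : Type u} [L.Structure M] [L.Structure N]
    [L.Structure P] [L.Structure W] {ι : M →[L] N} {I : Type v₁} {J : Type v₂} {b : M →[L] P}
    {e : I → N →[L] P} {x : J → P} (h : IsAmalgam T ι b e x) (hP : IsModel T P) {ε : N →[L] W}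
    {Γ : Type v₃} {y : Γ → W} (hW : FreelyGeneratesOver T ε y) {S : Type v₄} {β : S → W}
    (hS : FreelyGeneratesOver T (ε.comp ι) β) (hM : IsFree T M) {J₁ : Type w}
    (τ : J ≃ J₁ ⊕ I × Γ) : IsFree T P := by
  -- With a block of generators for every copy, all copies are absorbed; what remains is free over
  -- the free algebra `M`.
  obtain ⟨x', hx', -⟩ := h.absorb hP hW hS Set.univ
    (τ.trans (Equiv.sumCongr (Equiv.refl _)
      ((Equiv.Set.univ I).symm.prodCongr (Equiv.refl _))))
  have : IsEmpty ↥(Set.univ : Set I)ᶜ := ⟨fun i => i.2 trivial⟩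
  obtain ⟨_, hbasis⟩ := hM.exists_freelyGenerates
  exact (hx'.freelyGeneratesOver.freelyGenerates hbasis).isFree

/-- The first closing off argument: a free amalgam is, over the part generated by `M` and
by new free generators, an amalgam of the remaining copies of `N` as well as free. -/
theorem IsAmalgam.exists_freelyGeneratesOver_of_isFree [L.IsAlgebraic] {M N P W : Type u}
    [L.Structure M] [L.Structure N] [L.Structure P] [L.Structure W] {ι : M →[L] N} {I J : Type u}
    {b : M →[L] P} {e : I → N →[L] P} {x : J → P} (h : IsAmalgam T ι b e x) (hP : IsModel T P)
    {ε : N →[L] W} {y : ℕ → W} (hW : FreelyGeneratesOver T ε y) {S : Type u} {β : S → W}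
    (hS : FreelyGeneratesOver T (ε.comp ι) β) (hM : #M ≤ ℵ₀) (hN : #N ≤ ℵ₀) (hJ : ℵ₀ ≤ #J)
    (hIJ : #J < #I) (hfree : IsFree T P) :
    ∃ (K : Type u) (J' : Type u) (Z : Type u) (e' : K → N →[L] P) (x' : J' → P) (z : Z → P),
      Infinite K ∧ Infinite J' ∧ IsAmalgam T ι b e' x' ∧
      FreelyGeneratesOver T b (Sum.elim x' z) := by
  obtain ⟨B, hB⟩ := hfree.exists_freelyGenerates
  -- One index set carries both families, padded by `∅`: a point standing for `M` and all of `x`,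
  -- then the copies, then the basis elements. The point is forced into `Θ`.
  obtain ⟨Θ, hΘ₀, hΘ, hGH⟩ := exists_closure_eq_closure (L := L) (A := P)
    (Θ := PUnit.{u + 1} ⊕ I ⊕ B)
    (G := Sum.elim (fun _ => Set.range b ∪ Set.range x)
      (Sum.elim (fun i => Set.range (e i)) fun _ => ∅))
    (H := Sum.elim (fun _ => ∅) (Sum.elim (fun _ => ∅) fun c => {(c : P)})) hJ
    (by
      rintro (_ | i | c)
      · exact mk_union_le_of_le hJ (mk_range_le.trans (hM.trans hJ)) mk_range_le
      · exact mk_range_le.trans (hN.trans hJ)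
      · simp)
    (by
      rintro (_ | i | c)
      · simp
      · simp
      · simpa using one_le_aleph0.trans hJ)
    (by
      rw [eq_top_iff, ← h.gen, amalgamSpan]
      refine closure_mono ?_
      simp only [Set.iUnion_sumElim, Set.iUnion_const, Set.iUnion_empty]
      intro p hp
      simp only [Set.mem_union] at hp ⊢
      tauto)
    (by
      rw [eq_top_iff, ← hB.gen]
      refine closure_mono ?_
      simp [Set.iUnion_sumElim])
    (Θ₀ := {Sum.inl PUnit.unit}) (by simpa using one_le_aleph0.trans hJ)
  have hunit : Sum.inl PUnit.unit ∈ Θ := hΘ₀ rfl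
  let X : Set I := {i | Sum.inr (Sum.inl i) ∈ Θ}
  let B₀ : Set B := {c | Sum.inr (Sum.inr c) ∈ Θ}
  have hXJ : #X ≤ #J := (mk_preimage_of_injective _ Θ
    (Sum.inr_injective.comp Sum.inl_injective)).trans hΘ
  have hspan : amalgamSpan b (fun i : X => e i) x =
      closure L ((fun c : B => (c : P)) '' B₀) := by
    have hl : (⋃ θ ∈ Θ, Sum.elim (fun _ : PUnit.{u + 1} => Set.range b ∪ Set.range x)
        (Sum.elim (fun i => Set.range (e i)) fun _ : B => ∅) θ) =
        Set.range b ∪ (⋃ i : X, Set.range (e i)) ∪ Set.range x := by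
      ext p
      simp only [Set.iUnion_sum, Set.mem_union, Set.mem_iUnion, Sum.elim_inl, Sum.elim_inr,
        Set.mem_empty_iff_false, exists_prop, Subtype.exists, and_false, exists_false, or_false,
        exists_const, hunit, true_and, X, Set.mem_ofPred_eq]
      exact or_right_comm
    have hr : (⋃ θ ∈ Θ, Sum.elim (fun _ : PUnit.{u + 1} => (∅ : Set P))
        (Sum.elim (fun _ : I => ∅) fun c : B => {(c : P)}) θ) =
        (fun c : B => (c : P)) '' B₀ := by
      ext p
      simp only [Set.iUnion_sum, Set.mem_union, Set.mem_iUnion, Sum.elim_inl, Sum.elim_inr,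
        Set.mem_empty_iff_false, exists_prop, and_false, exists_false, false_or, Set.mem_image,
        B₀, Set.mem_ofPred_eq, Set.mem_singleton_iff, eq_comm]
    rw [amalgamSpan, ← hl, hGH, hr]
  -- At most `#J` copies are to be absorbed, so `J` can spare countably many generators for each and
  -- still keep `#J` of them.
  obtain ⟨τ⟩ : Nonempty (J ≃ J ⊕ X × ℕ) := by
    refine Cardinal.eq.1 ?_
    rw [mk_sum, mk_prod, Cardinal.lift_id, Cardinal.lift_id, lift_uzero, mk_nat, lift_aleph0]
    exact (add_eq_left hJ (mul_le_of_le hJ hXJ hJ)).symm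
  obtain ⟨x', hx', hspan'⟩ := h.absorb hP hW hS X τ
  have hι := ExtendsAlong.of_freelyGeneratesOver hS
  have : Infinite J := infinite_iff.2 hJ
  have hK : Infinite ↥Xᶜ := by
    rw [infinite_iff]
    by_contra! hlt
    refine hIJ.not_ge ?_
    rw [← mk_sum_compl X]
    exact (add_le_add hXJ (hlt.le.trans hJ)).trans (add_eq_self hJ).le
  refine ⟨↥Xᶜ, J ⊕ X × S, ↥B₀ᶜ, fun i => e i, x', fun c => c, hK, inferInstance, hx',
    hB.freelyGeneratesOver_compl (hspan'.trans hspan) fun C _ hC g s => ?_⟩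
  obtain ⟨k, hk⟩ := hι C hC ⟨s (Sum.inl (Classical.arbitrary J))⟩ g
  obtain ⟨f, h₁, -, h₃⟩ := hx'.ext C hC g (fun _ => k) s fun _ => hk
  exact ⟨f, h₁, h₃⟩

/-- The second closing off argument: if an amalgam of infinitely many copies of `N` and a free
algebra is free over `M` and the free algebra, then so is a countable one. -/
theorem IsAmalgam.exists_countable {M N P : Type u} [L.Structure M] [L.Structure N]
    [L.Structure P] {ι : M →[L] N} {K J Z : Type u} [Infinite K] [Infinite J]
    {b : M →[L] P} {e : K → N →[L] P} {x : J → P} {z : Z → P} (h : IsAmalgam T ι b e x)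
    (hz : FreelyGeneratesOver T b (Sum.elim x z)) (hι : ExtendsAlong T ι)
    (hM : #M ≤ ℵ₀) (hN : #N ≤ ℵ₀) :
    ∃ (D : L.Substructure P) (b' : M →[L] D) (e' : ℕ → N →[L] D) (x' : ℕ → D) (Z' : Set Z)
      (z' : Z' → D), IsAmalgam T ι b' e' x' ∧ FreelyGeneratesOver T b' (Sum.elim x' z') := by
  -- Both families contain `M` and the `x j`, so the closed part uses the same subset of `J` in the
  -- two descriptions of `P`.
  obtain ⟨Θ, hΘ₀, hΘ, hGH⟩ := exists_closure_eq_closure (L := L) (A := P)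
    (Θ := PUnit.{u + 1} ⊕ K ⊕ J ⊕ Z)
    (G := Sum.elim (fun _ => Set.range b)
      (Sum.elim (fun i => Set.range (e i)) (Sum.elim (fun j => {x j}) fun _ => ∅)))
    (H := Sum.elim (fun _ => Set.range b)
      (Sum.elim (fun _ => ∅) (Sum.elim (fun j => {x j}) fun i => {z i}))) le_rfl
    (by
      rintro (_ | i | j | i)
      · exact mk_range_le.trans hM
      · exact mk_range_le.trans hN
      · simp
      · simp)
    (by
      rintro (_ | i | j | i)
      · exact mk_range_le.trans hM
      · simp
      · simp
      · simp)
    (by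
      rw [eq_top_iff, ← h.gen, amalgamSpan]
      refine closure_mono (Eq.subset ?_)
      simp only [Set.iUnion_sumElim, Set.iUnion_const, Set.iUnion_empty, Set.union_empty,
        Set.union_assoc, Set.iUnion_singleton_eq_range])
    (by
      rw [eq_top_iff, ← hz.gen]
      refine closure_mono (Eq.subset ?_)
      simp only [Set.iUnion_sumElim, Set.iUnion_const, Set.empty_union,
        Set.iUnion_singleton_eq_range, Set.Sum.elim_range])
    -- Infinitely many copies and generators are put in at the start, so that the countable sets
    -- obtained can be indexed by `ℕ`.
    (Θ₀ := insert (Sum.inl PUnit.unit) (Set.range (fun n => Sum.inr (Sum.inl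
      (Infinite.natEmbedding K n))) ∪ Set.range (fun n => Sum.inr (Sum.inr (Sum.inl
      (Infinite.natEmbedding J n))))))
    (((Set.countable_range _).union (Set.countable_range _)).insert _).le_aleph0
  have hunit : Sum.inl PUnit.unit ∈ Θ := hΘ₀ (Or.inl rfl)
  have hΘc : Θ.Countable := mk_le_aleph0_iff.1 hΘ
  let X : Set K := {i | Sum.inr (Sum.inl i) ∈ Θ}
  let Y : Set J := {j | Sum.inr (Sum.inr (Sum.inl j)) ∈ Θ}
  let Z' : Set Z := {i | Sum.inr (Sum.inr (Sum.inr i)) ∈ Θ}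
  have hXc : X.Countable := hΘc.preimage (Sum.inr_injective.comp Sum.inl_injective)
  have hYc : Y.Countable :=
    hΘc.preimage (Sum.inr_injective.comp (Sum.inr_injective.comp Sum.inl_injective))
  have hXi : X.Infinite := (Set.infinite_range_of_injective
    (Infinite.natEmbedding K).injective).mono (by
      rintro _ ⟨n, rfl⟩
      exact hΘ₀ (Or.inr (Or.inl ⟨n, rfl⟩)))
  have hYi : Y.Infinite := (Set.infinite_range_of_injective
    (Infinite.natEmbedding J).injective).mono (by
      rintro _ ⟨n, rfl⟩
      exact hΘ₀ (Or.inr (Or.inr ⟨n, rfl⟩)))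
  have hG : closure L (⋃ θ ∈ Θ, Sum.elim (fun _ : PUnit.{u + 1} => Set.range b)
      (Sum.elim (fun i => Set.range (e i)) (Sum.elim (fun j => {x j}) fun _ : Z => ∅)) θ) =
      amalgamSpan b (fun i : X => e i) (fun j : Y => x j) := by
    rw [amalgamSpan]
    congr 1
    ext p
    simp only [Set.iUnion_sum, Set.mem_union, Set.mem_iUnion, Sum.elim_inl, Sum.elim_inr,
      Set.mem_empty_iff_false, exists_prop, Subtype.exists, and_false, exists_false, or_false,
      exists_const, hunit, true_and, X, Y, Set.mem_ofPred_eq, Set.mem_singleton_iff,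
      Set.mem_range, or_assoc, eq_comm]
  let u : Y ⊕ Z' → J ⊕ Z := Sum.map Subtype.val Subtype.val
  have hu : u.Injective := Sum.map_injective.2 ⟨Subtype.val_injective, Subtype.val_injective⟩
  have hH : closure L (⋃ θ ∈ Θ, Sum.elim (fun _ : PUnit.{u + 1} => Set.range b)
      (Sum.elim (fun _ : K => ∅) (Sum.elim (fun j => {x j}) fun i => {z i})) θ) =
      closure L (Set.range b ∪ Set.range (Sum.elim x z ∘ u)) := by
    congr 1
    ext p
    simp only [Set.iUnion_sum, Set.mem_union, Set.mem_iUnion, Sum.elim_inl, Sum.elim_inr,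
      Set.mem_empty_iff_false, exists_prop, Subtype.exists, and_false, exists_false, false_or,
      exists_const, hunit, true_and, Z', Y, Set.mem_ofPred_eq, Set.mem_singleton_iff,
      Set.mem_range, eq_comm, u, Sum.exists, Function.comp_apply, Sum.map_inl, Sum.map_inr]
  have hGH' := hG.symm.trans (hGH.trans hH)
  obtain ⟨h₁, h₂, h₃⟩ := amalgamSpan_le.1
    (le_refl (amalgamSpan b (fun i : X => e i) (fun j : Y => x j)))
  have h₄ (i : Z') : z i ∈ amalgamSpan b (fun i : X => e i) (fun j : Y => x j) := by
    rw [hGH']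
    exact Substructure.subset_closure (Or.inr ⟨Sum.inr i, rfl⟩)
  have := hXc.to_subtype
  have := hYc.to_subtype
  have := hXi.to_subtype
  have := hYi.to_subtype
  obtain ⟨σ⟩ := nonempty_equiv_of_countable (α := ℕ) (β := X)
  obtain ⟨τ⟩ := nonempty_equiv_of_countable (α := ℕ) (β := Y)
  refine ⟨_, b.codRestrict _ h₁, fun i => (e (σ i)).codRestrict _ (h₂ (σ i)),
    fun j => ⟨x (τ j), h₃ (τ j)⟩, Z', fun i => ⟨z i, h₄ i⟩, ?_, ?_⟩
  · refine h.sub hι (Subtype.val_injective.comp σ.injective)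
      (Subtype.val_injective.comp τ.injective) ?_ (fun _ => rfl) (fun _ _ => rfl) fun _ => rfl
    apply le_antisymm
    · obtain ⟨h₁, h₂, h₃⟩ := amalgamSpan_le.1
        (le_refl (amalgamSpan b (e ∘ Subtype.val ∘ σ) (x ∘ Subtype.val ∘ τ)))
      exact amalgamSpan_le.2 ⟨h₁, fun i n => by simpa using h₂ (σ.symm i) n,
        fun j => by simpa using h₃ (τ.symm j)⟩
    · exact amalgamSpan_le.2 ⟨h₁, fun i => h₂ (σ i), fun j => h₃ (τ j)⟩
  · refine hz.sub (u := u ∘ Sum.map τ id)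
      (hu.comp (Sum.map_injective.2 ⟨τ.injective, Function.injective_id⟩)) ?_ (fun _ => rfl) ?_
    · rw [hGH', ← Function.comp_assoc, Function.Surjective.range_comp (f := Sum.map τ id)
        (Sum.map_surjective.2 ⟨τ.surjective, Function.surjective_id⟩) (Sum.elim x z ∘ u)]
    · rintro (j | i) <;> rfl

end Variety

namespace Variety

open Substructure Cardinal

universe v v₁ v₂

variable {L : FirstOrder.Language.{0, 0}} {T : Equations L}

/-! ### Almost freeness and the main theorem -/

theorem exists_rank (I : Type u) :
    ∃ ρ : I → Ordinal.{u}, ρ.Injective ∧ ∀ i, ρ i < (#I).ord := by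
  obtain ⟨f⟩ := Cardinal.eq.1 (mk_ord_toType #I)
  refine ⟨fun i => Ordinal.typein (α := (#I).ord.ToType) (· < ·) (f.symm i), ?_, fun i => ?_⟩
  · exact (Ordinal.typein_injective _).comp f.symm.injective
  · exact Ordinal.typein_lt_self _

theorem mk_rank_lt_le {I : Type u} {ρ : I → Ordinal.{u}} (hρ : ρ.Injective) (o : Ordinal.{u}) :
    #{i // ρ i < o} ≤ o.card := by
  have h := lift_mk_le_lift_mk_of_injective
    (f := fun i : {i // ρ i < o} => (⟨ρ i, i.2⟩ : Set.Iio o))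
    fun i j hij => Subtype.ext (hρ (congrArg Subtype.val hij))
  rw [mk_Iio_ordinal, lift_lift] at h
  exact lift_le.1 h

/-- Any index of rank below a limit `o` has rank below some `j < o`, and directed unions of
subalgebras are subalgebras. This gives continuity of the filtration and, for `o` the initial
ordinal of `#I`, that it exhausts `P`. -/
theorem coe_amalgamSpan_eq_iUnion {M N P : Type u} [L.Structure M] [L.Structure N]
    [L.Structure P] {I : Type v₁} {J : Type v₂} (b : M →[L] P) (e : I → N →[L] P) (x : J → P)
    (ρ : I → Ordinal.{w}) {o : Ordinal.{w}} (ho : Order.IsSuccLimit o) :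
    (amalgamSpan b (fun i : {i // ρ i < o} => e i) x : Set P) =
      ⋃ j < o, (amalgamSpan b (fun i : {i // ρ i < j} => e i) x : Set P) := by
  have hmono {j k : Ordinal.{w}} (hjk : j ≤ k) :
      amalgamSpan b (fun i : {i // ρ i < j} => e i) x ≤
        amalgamSpan b (fun i : {i // ρ i < k} => e i) x := by
    obtain ⟨h₁, h₂, h₃⟩ := amalgamSpan_le.1
      (le_refl (amalgamSpan b (fun i : {i // ρ i < k} => e i) x))
    exact amalgamSpan_le.2 ⟨h₁, fun i => h₂ ⟨i, i.2.trans_le hjk⟩, h₃⟩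
  have hpos : 0 < o := ho.bot_lt
  have : Nonempty (Set.Iio o) := ⟨⟨0, hpos⟩⟩
  apply Set.Subset.antisymm
  · have hle : amalgamSpan b (fun i : {i // ρ i < o} => e i) x ≤
        ⨆ j : Set.Iio o, amalgamSpan b (fun i : {i // ρ i < (j : Ordinal)} => e i) x := by
      refine amalgamSpan_le.2 ⟨fun m => ?_, fun i n => ?_, fun j => ?_⟩
      · exact le_iSup (fun j : Set.Iio o => amalgamSpan b (fun i : {i // ρ i < j.1} => e i) x)
          ⟨0, hpos⟩ ((amalgamSpan_le.1 le_rfl).1 m)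
      · exact le_iSup (fun j : Set.Iio o => amalgamSpan b (fun i : {i // ρ i < j.1} => e i) x)
          ⟨Order.succ (ρ i), ho.succ_lt i.2⟩
          ((amalgamSpan_le (e := fun k : {k // ρ k < Order.succ (ρ i)} => e k).1 le_rfl).2.1
            ⟨i, Order.lt_succ _⟩ n)
      · exact le_iSup (fun j : Set.Iio o => amalgamSpan b (fun i : {i // ρ i < j.1} => e i) x)
          ⟨0, hpos⟩ ((amalgamSpan_le.1 le_rfl).2.2 j)
    intro p hp
    obtain ⟨j, hj⟩ := (mem_iSup_of_directed (Monotone.directed_le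
      fun j k : Set.Iio o => fun hjk => hmono hjk)).1 (hle hp)
    exact Set.mem_biUnion j.2 hj
  · exact Set.iUnion₂_subset fun j hj => hmono hj.le

/-- Every stage contains the whole free part on `J`: a proper initial segment has at most `#J`
copies, and these are absorbed by the generators. Regularity of the successor cardinal makes the
length of the chain right. -/
theorem IsAmalgam.isAlmostFree [L.IsAlgebraic] [Countable (Σ n, L.Functions n)]
    {M N P W : Type u} [L.Structure M] [L.Structure N] [L.Structure P] [L.Structure W]
    {ι : M →[L] N} {I J : Type u} {b : M →[L] P} {e : I → N →[L] P} {x : J → P}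
    (h : IsAmalgam T ι b e x) (hP : IsModel T P) {ε : N →[L] W} {y : ℕ → W}
    (hW : FreelyGeneratesOver T ε y) {S : Type u} {β : S → W}
    (hS : FreelyGeneratesOver T (ε.comp ι) β) (hMfree : IsFree T M) (hM : #M ≤ ℵ₀)
    (hN : #N ≤ ℵ₀) (hJ : ℵ₀ ≤ #J) (hIJ : #I = Order.succ #J) (hPI : #P = #I) :
    IsAlmostFree T P := by
  obtain ⟨ρ, hρ, hρI⟩ := exists_rank I
  have hcof : (#P).ord.cof.ord = (#I).ord := by
    rw [hPI, hIJ, (isRegular_succ hJ).cof_ord]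
  have hlim : Order.IsSuccLimit (#I).ord :=
    isSuccLimit_ord (hJ.trans ((Order.le_succ _).trans hIJ.ge))
  have hι := ExtendsAlong.of_freelyGeneratesOver hS
  have : Infinite J := infinite_iff.2 hJ
  refine ⟨fun o => amalgamSpan b (fun i : {i // ρ i < o} => e i) x, fun j k hjk _ => ?_,
    fun o ho _ => coe_amalgamSpan_eq_iUnion b e x ρ ho, fun o ho => ?_, ?_⟩
  · obtain ⟨h₁, h₂, h₃⟩ := amalgamSpan_le.1
      (le_refl (amalgamSpan b (fun i : {i // ρ i < k} => e i) x))
    exact amalgamSpan_le.2 ⟨h₁, fun i => h₂ ⟨i, i.2.trans_le hjk⟩, h₃⟩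
  · have hX : #{i // ρ i < o} ≤ #J := by
      refine (mk_rank_lt_le hρ o).trans ?_
      rwa [← Order.lt_succ_iff, ← hIJ, ← lt_ord, ← hcof]
    refine ⟨?_, ?_⟩
    · obtain ⟨h₁, h₂, h₃⟩ := amalgamSpan_le.1
        (le_refl (amalgamSpan b (fun i : {i // ρ i < o} => e i) x))
      have hsub := h.sub hι (σ := (Subtype.val : {i // ρ i < o} → I)) Subtype.val_injective
        (u := id) Function.injective_id rfl (b' := b.codRestrict _ h₁)
        (e' := fun i => (e i).codRestrict _ (h₂ i)) (x' := fun j => ⟨x j, h₃ j⟩) (fun _ => rfl)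
        (fun _ _ => rfl) (fun _ => rfl)
      obtain ⟨τ⟩ : Nonempty (J ≃ J ⊕ {i // ρ i < o} × ℕ) := by
        refine Cardinal.eq.1 ?_
        rw [mk_sum, mk_prod, Cardinal.lift_id, Cardinal.lift_id, lift_uzero, mk_nat, lift_aleph0]
        exact (add_eq_left hJ (mul_le_of_le hJ hX hJ)).symm
      exact hsub.isFree (hP.substructure _) hW hS hMfree τ
    · refine (mk_amalgamSpan_le b _ x hJ (hM.trans hJ) (hN.trans hJ) hX le_rfl).trans_lt ?_
      rw [hPI, hIJ]
      exact Order.lt_succ _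
  · rw [hcof, ← coe_amalgamSpan_eq_iUnion b e x ρ hlim]
    obtain ⟨h₁, h₂, h₃⟩ := amalgamSpan_le.1
      (le_refl (amalgamSpan b (fun i : {i // ρ i < (#I).ord} => e i) x))
    exact Set.eq_univ_of_forall (h.eq_top h₁ (fun i => h₂ ⟨i, hρI i⟩) h₃)

/-- Two homomorphisms on `N` that agree on `M` but differ at `n` separate the copies of `n`: use `f`
on one copy and `f'` on all others. -/
theorem IsAmalgam.mk_eq [Countable (Σ n, L.Functions n)] {M N P C : Type u} [L.Structure M]
    [L.Structure N] [L.Structure P] [L.Structure C] {ι : M →[L] N} {I J : Type u} {b : M →[L] P}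
    {e : I → N →[L] P} {x : J → P} (h : IsAmalgam T ι b e x) (hM : #M ≤ ℵ₀) (hN : #N ≤ ℵ₀)
    (hI : ℵ₀ ≤ #I) (hJI : #J ≤ #I) (hC : IsModel T C) {f f' : N →[L] C}
    (hff' : ∀ m, f (ι m) = f' (ι m)) {n : N} (hn : f n ≠ f' n) : #P = #I := by
  classical
  apply le_antisymm
  · have h' := mk_amalgamSpan_le b e x hI (hM.trans hI) (hN.trans hI) le_rfl hJI
    rw [h.gen] at h'
    rwa [← mk_univ, ← Substructure.coe_top (L := L)]
  · refine mk_le_of_injective (f := fun i => e i n) fun i j hij => ?_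
    by_contra hne
    obtain ⟨k, -, hk, -⟩ := h.ext C hC (f.comp ι) (fun l => if l = i then f else f')
      (fun _ => f n) fun l m => by
        split_ifs
        exacts [rfl, (hff' m).symm]
    have h₁ := hk i n
    have h₂ := hk j n
    rw [if_pos rfl] at h₁
    rw [if_neg (Ne.symm hne)] at h₂
    exact hn (h₁.symm.trans ((congrArg k hij).trans h₂))

/-! ### Amalgams built from a witness of `Pr₁(T)` -/

variable [L.IsAlgebraic]

theorem isFree_freeAlg (X : Type u) : IsFree T (FreeAlg T X) := by
  refine FreelyGenerates.isFree (x := Presented.gen T noEquations) ⟨?_, fun C _ hC s =>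
    ⟨Presented.lift hC s fun _ _ h => h.elim, fun _ => rfl⟩⟩
  refine eq_top_iff.2 fun c hc => ?_
  clear hc
  obtain ⟨t, rfl⟩ := Presented.mk_surjective c
  induction t with
  | var i => exact Substructure.subset_closure ⟨i, rfl⟩
  | func f ts ih =>
    rw [← Presented.funMap_mk]
    exact Substructure.fun_mem _ f _ ih

/-- The free product of the copies of `N` over `M` with a free algebra is an amalgam. -/
theorem isAmalgam_freeProduct {N : Type (max u w)} [L.Structure N] (M : L.Substructure N)
    (I J : Type w) :
    IsAmalgam.{max u w} T M.subtype.toHom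
      ((FreeProduct.inl T (B := FreeAlg T J)).comp
        (FreeProductOver.base T fun _ : I => M.subtype))
      (fun i => (FreeProduct.inl T (B := FreeAlg T J)).comp
        (FreeProductOver.factor (T := T) (fun _ : I => M.subtype) i))
      (fun j : J => FreeProduct.inr T (A := CopiesOver T M I) (Presented.gen T _ j)) :=
  ((isAmalgam_copiesOver.{u, w} M I).adjoin freelyGeneratesOver_inl.{u, w}).reindex
    (Equiv.refl I) (Equiv.emptySum PEmpty J).symm

namespace WitnessesPrOne

variable {N : Type u} [L.Structure N] {M : L.Substructure N}

theorem mk_le [Countable (Σ n, L.Functions n)] (h : WitnessesPrOne T N M) : #N ≤ ℵ₀ :=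
  mk_le_aleph0_iff.2 (Structure.cg_iff_countable.1 h.countablyGenerated)

/-- No countable amalgam over `M` and a free algebra is free over these. -/
theorem not_freelyGeneratesOver (h : WitnessesPrOne T N M) {Z : Type v}
    (z : Z → FreeProduct T (CopiesOver T M ℕ) (FreeAlg T ℕ)) :
    ¬ FreelyGeneratesOver.{u, v} T (FreeProduct.map T
      (FreeProductOver.base T fun _ : ℕ => M.subtype) (Hom.id L (FreeAlg T ℕ))) z := by
  intro hz
  -- `M ∗ F_ω` maps to every nonempty algebra in the variety because `M` is free: send all
  -- generators to one point.
  refine h.not_free_over (hz.isFreeOver (Presented.isModel T _) fun C _ hC hne => ?_)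
  obtain ⟨c⟩ := hne
  obtain ⟨_, hbasis⟩ := h.base_free.exists_freelyGenerates
  obtain ⟨g, -⟩ := hbasis.ext C hC fun _ => c
  obtain ⟨f, -⟩ := (freelyGeneratesOver_inl.{u, 0} (T := T) (A := M) (X := ℕ)).ext C hC g
    fun _ => c
  exact ⟨f⟩

end WitnessesPrOne

theorem WitnessesPrOne.exemplifies [Countable (Σ n, L.Functions n)] {N : Type u} [L.Structure N]
    {M : L.Substructure N} (h : WitnessesPrOne T N M) {I J : Type u} (hJ : ℵ₀ ≤ #J)
    (hIJ : #I = Order.succ #J) :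
    Exemplifies T #I (FreeProduct T (CopiesOver T M I) (FreeAlg T J)) := by
  have hN := h.mk_le
  have hM : #M ≤ ℵ₀ := (mk_set_le (M : Set N)).trans hN
  have hW := freelyGeneratesOver_inl.{u, 0} (T := T) (A := N) (X := ℕ)
  obtain ⟨S, hS⟩ := h.free_over.exists_freelyGeneratesOver
  have hι := ExtendsAlong.of_freelyGeneratesOver hS
  have hA := freelyGeneratesOver_inl.{u, 0} (T := T) (A := M) (X := ℕ)
  have hR := isAmalgam_freeProduct.{u, 0} (T := T) M ℕ ℕ
  have hP := isAmalgam_freeProduct.{u, u} (T := T) M I J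
  have hPT : IsModel T (FreeProduct T (CopiesOver T M I) (FreeAlg T J)) := Presented.isModel T _
  have hlt : #J < #I := hIJ ▸ Order.lt_succ _
  have hI := hJ.trans hlt.le
  have hcard : #(FreeProduct T (CopiesOver T M I) (FreeAlg T J)) = #I := by
    -- If the cardinality were wrong, `mk_eq` would make homomorphisms on `N` determined by `M`, and
    -- the countable amalgam would be free with empty basis.
    by_contra hne
    refine h.not_freelyGeneratesOver _ (hR.freelyGeneratesOver_of_epi (Presented.isModel T _) hι hA
      (fun _ => rfl) (fun _ => rfl) fun C _ hC f f' hff' n => ?_)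
    by_contra hn
    exact hne (hP.mk_eq hM hN hI hlt.le hC hff' hn)
  refine ⟨hPT, hcard, hP.isAlmostFree hPT hW hS h.base_free hM hN hJ hIJ hcard, ?_, ?_⟩
  -- The extra free factor supplies exactly one countable block of generators for each copy, so
  -- absorption applies with the identity as `τ`.
  · refine ⟨FreeAlg T (I × ℕ), inferInstance, Presented.isModel T _, isFree_freeAlg _, ?_⟩
    exact (hP.adjoin freelyGeneratesOver_inl.{u, u}).isFree (Presented.isModel T _) hW hS
      h.base_free (Equiv.refl _)
  · intro hfree
    obtain ⟨K, J', Z, e', x', z, _, _, hP', hz⟩ :=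
      hP.exists_freelyGeneratesOver_of_isFree hPT hW hS hM hN hJ hlt hfree
    obtain ⟨D, b', e'', x'', Z', z', hD, hz'⟩ := hP'.exists_countable hz hι hM hN
    -- The countable amalgam `D` found inside `P` is compared with the one presented in `Pr₁(T)`,
    -- where freeness is excluded.
    obtain ⟨z'', hz''⟩ := hD.freelyGeneratesOver_of_equiv hR (hPT.substructure D)
      (Presented.isModel T _) hA (φ := FreeProduct.map T
        (FreeProductOver.base T fun _ : ℕ => M.subtype) (Hom.id L (FreeAlg T ℕ)))
      (fun _ => rfl) (fun _ => rfl) hz'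
    exact h.not_freelyGeneratesOver _ hz''

end Variety

theorem theorem2p2 {L : FirstOrder.Language.{0, 0}} [L.IsAlgebraic]
    [Countable (Σ n, L.Functions n)] (T : Variety.Equations L) :
    (Variety.PrOne.{u} T →
      ∀ μ : Cardinal.{u}, ℵ₀ ≤ μ → Order.succ μ ∈ Variety.EINC.{u} T) ∧
    (∀ (N : Type u) [L.Structure N] (M : L.Substructure N), Variety.WitnessesPrOne T N M →
      ∀ I J : Type u, ℵ₀ ≤ #J → #I = Order.succ #J →
        Variety.Exemplifies T #I
          (Variety.FreeProduct T (Variety.CopiesOver T M I) (Variety.FreeAlg T J))) := by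
  refine ⟨?_, fun N _ M h I J hJ hIJ => h.exemplifies hJ hIJ⟩
  rintro ⟨N, _, M, h⟩ μ hμ
  have hex := h.exemplifies (I := (Order.succ μ).out) (J := μ.out) (by rwa [Cardinal.mk_out])
    (by rw [Cardinal.mk_out, Cardinal.mk_out])
  rw [Cardinal.mk_out] at hex
  exact ⟨_, _, hex⟩
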